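/- **Theorem.** There is an absolute constant $C$ such that for every integer $n\ge 1$ there is an abstract tile assembly (aTAM) system $\Gamma=(T,\sigma,2)$ at temperature $2$, whose seed $\sigma$ is a single tile of a type in $T$, with the following properties. 1. $|T|\le C(1+\log n)$, i.e. $\Gamma$ has $O(\log n)$ tile types. 2. $\Gamma$ is $2$-extensible: to every producible assembly, tiles can stably attach at no more than $2$ different locations. 3. $\Gamma$ is a fair robust random $n$ generator: $\Gamma$ is finite (every producible assembly can grow into a terminal one), and its set of terminal assemblies can be partitioned into $n$ sets $X_1,\dots,X_n$, independent of the concentrations, such that for every concentration distribution $P$ on $T$ and all $i,j$ $$\sum_{\alpha\in X_i}\Pr\nolimits_P[\Gamma\to\alpha]=\sum_{\alpha\in X_j}\Pr\nolimits_P[\Gamma\to\alpha].$$ Moreover $\sum_{\alpha\ \mathrm{terminal}}\Pr_P[\Gamma\to\alpha]=1$, so each of these sums is $1/n$. 4. For every concentration distribution $P$ the expected space satisfies $\sum_{\alpha\ \mathrm{terminal}}|\alpha|\cdot\Pr_P[\Gamma\to\alpha]\le C(1+\log n)$, where $|\alpha|$ is the number of tiles of $\alpha$. Here a tile is a unit square,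 possibly with a label, with a glue on each edge, and each glue has a non-negative integer strength. Tiles may be translated but not rotated, and an assembly is a finite set of tiles at distinct positions of $\mathbb Z^2$. Two adjacent tiles are bonded with the strength of the glue on their abutting edges if these glues agree, and with strength $0$ otherwise. An assembly is stable if every cut of its bond graph has weight at least the temperature $2$. The producible assemblies are obtained from $\sigma$ by successively attaching single tiles of types in $T$ such that each resulting assembly is stable; a terminal assembly is a producible one to which nothing can attach. A concentration distribution is a function $P:T\to(0,1]$ with $\sum_{t\in T}P(t)=1$. The assembly process is the Markov chain started at $\sigma$ in which each possible attachment to the current assembly is chosen with probability proportional to the concentration of its tile type, and $\Pr_P[\Gamma\to\alpha]$ is the probability that it ends in $\alpha$. -/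

import Mathlib

open scoped NNReal ENNReal

namespace ATAM

/-- A tile (type): a unit square whose four edges carry glues from the alphabet `G`, together with
a finite string label (the empty string for an unlabelled tile). Tiles are never rotated. -/
structure Tile (G : Type) where
  north : G
  east : G
  south : G
  west : G
  label : String

/-- A translated copy of a tile, centred at a point of the integer lattice. -/
structure PlacedTile (G : Type) where
  tile : Tile G
  pos : ℤ × ℤ

/-- An assembly: a finite set of tiles at pairwise distinct positions. -/
@[ext] structure Assembly (G : Type) where
  tiles : Finset (PlacedTile G)
  pos_unique : ∀ a ∈ tiles, ∀ b ∈ tiles, a.pos = b.pos → a = b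

variable {G : Type}

open Classical in
/-- The weight of the edge between `a` and `b` in the bond graph: the strength of the glue shared by
the two abutting edges, and `0` if `a` and `b` are not adjacent or these two glues differ. -/
noncomputable def bond (str : G → ℕ) (a b : PlacedTile G) : ℕ :=
  if b.pos = a.pos + (1, 0) ∧ a.tile.east = b.tile.west then str a.tile.east
  else if b.pos = a.pos + (-1, 0) ∧ a.tile.west = b.tile.east then str a.tile.west
  else if b.pos = a.pos + (0, 1) ∧ a.tile.north = b.tile.south then str a.tile.north
  else if b.pos = a.pos + (0, -1) ∧ a.tile.south = b.tile.north then str a.tile.south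
  else 0

namespace Assembly

/-- The space of an assembly: its number of tiles. -/
def space (α : Assembly G) : ℕ := α.tiles.card

open Classical in
/-- `τ`-stability: every cut of the bond graph has weight at least `τ`. -/
def Stable (str : G → ℕ) (τ : ℕ) (α : Assembly G) : Prop :=
  ∀ S ⊆ α.tiles, S.Nonempty → S ≠ α.tiles →
    τ ≤ ∑ a ∈ S, ∑ b ∈ α.tiles \ S, bond str a b

end Assembly

/-- A tile system `Γ = (T, σ, τ)` over a glue alphabet `G` with glue strengths `strength`. The seed
consists of tiles of the types in `T`. -/
structure TileSystem (G : Type) where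
  strength : G → ℕ
  tileSet : Finset (Tile G)
  seed : Assembly G
  seed_mem : ∀ a ∈ seed.tiles, a.tile ∈ tileSet
  temperature : ℕ
  temperature_pos : 0 < temperature

/-- A concentration distribution over a tile set `T`; its values off `T` are never used. -/
structure Concentration (T : Finset (Tile G)) where
  conc : Tile G → ℝ≥0
  conc_pos : ∀ t ∈ T, 0 < conc t
  conc_sum : ∑ t ∈ T, conc t = 1

namespace TileSystem

variable (Γ : TileSystem G)

open Classical in
/-- `B` arises from `A` by the stable attachment of the single tile `b`, of a type in `T`. (Since `B`
is an assembly and `b` is not in `A`, the position of `b` is empty in `A`.) -/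
def Attaches (A : Assembly G) (b : PlacedTile G) (B : Assembly G) : Prop :=
  b.tile ∈ Γ.tileSet ∧ b ∉ A.tiles ∧ B.tiles = insert b A.tiles ∧
    B.Stable Γ.strength Γ.temperature

/-- `A →₁ B`: growth by one single-tile attachment. -/
def Step (A B : Assembly G) : Prop := ∃ b, Γ.Attaches A b B

/-- `A → B`: growth by zero or more single-tile attachments. -/
def Grows (A B : Assembly G) : Prop := Relation.ReflTransGen Γ.Step A B

/-- The set of producible assemblies. -/
def producible : Set (Assembly G) := {α | Γ.Grows Γ.seed α}

/-- The frontier of an assembly: the placed tiles that can stably attach to it. -/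
def frontier (A : Assembly G) : Set (PlacedTile G) := {b | ∃ B, Γ.Attaches A b B}

/-- The set of terminal assemblies: producible, and nothing can attach. -/
def terminal : Set (Assembly G) := {α | α ∈ Γ.producible ∧ Γ.frontier α = ∅}

/-- A tile system is finite if every producible assembly can grow into a terminal one. -/
def IsFinite : Prop := ∀ β ∈ Γ.producible, ∃ α ∈ Γ.terminal, Γ.Grows β α

/-- `k`-extensibility: at most `k` locations of any producible assembly admit an attachment. -/
def Extensible (k : ℕ) : Prop :=
  ∀ α ∈ Γ.producible, (PlacedTile.pos '' Γ.frontier α).encard ≤ k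

variable {Γ}

/-- The transition probability from `A` to `B`: the concentration of the tile whose attachment
turns `A` into `B` (there is at most one), divided by the total concentration of all possible
attachments to `A`. It is `0` if `A →₁ B` fails; in particular nothing leaves a terminal assembly. -/
noncomputable def trans (P : Concentration Γ.tileSet) (A B : Assembly G) : ℝ≥0∞ :=
  (∑' b : {b | Γ.Attaches A b B}, (P.conc b.1.tile : ℝ≥0∞)) /
    ∑' b : Γ.frontier A, (P.conc b.1.tile : ℝ≥0∞)

open Classical in
/-- `law P k A` is the probability that the assembly process, started in the seed, makes at least
`k` transitions and is in the state `A` after the `k`-th one. -/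
noncomputable def law (P : Concentration Γ.tileSet) : ℕ → Assembly G → ℝ≥0∞
  | 0, A => if A = Γ.seed then 1 else 0
  | k + 1, B => ∑' A, law P k A * trans P A B

/-- The probability that the process ends in the terminal assembly `A`. Every transition adds a
tile, so the events that `A` is the state after the `k`-th transition are pairwise disjoint. -/
noncomputable def probTerm (P : Concentration Γ.tileSet) (A : Assembly G) : ℝ≥0∞ :=
  ∑' k, law P k A

/-- The probability that the process ends in one of the terminal assemblies of `X`. -/
noncomputable def probOf (P : Concentration Γ.tileSet) (X : Set (Assembly G)) : ℝ≥0∞ :=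
  ∑' A : X, probTerm P A.1

/-- The expected space of the system relative to the concentration distribution `P`. -/
noncomputable def expectedSpace (P : Concentration Γ.tileSet) : ℝ≥0∞ :=
  ∑' A : Γ.terminal, (A.1.space : ℝ≥0∞) * probTerm P A.1

variable (Γ)

/-- A robust random `n` generator with bias `b`: a finite system whose terminal assemblies can be
partitioned into `n` sets, the same for all concentration distributions, whose probabilities differ
by at most `b` (as `i` and `j` may be exchanged, the inequality bounds the absolute difference). -/
def IsRobustRandomGenerator (n : ℕ) (b : ℝ≥0) : Prop :=
  Γ.IsFinite ∧ ∃ X : Fin n → Set (Assembly G),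
    (∀ i, (X i).Nonempty) ∧ Pairwise (Function.onFun Disjoint X) ∧ ⋃ i, X i = Γ.terminal ∧
    ∀ P : Concentration Γ.tileSet, ∀ i j, probOf P (X i) ≤ probOf P (X j) + b

/-- A fair robust random `n` generator: bias `0`. -/
def IsFairRobustRandomGenerator (n : ℕ) : Prop := Γ.IsRobustRandomGenerator n 0

end TileSystem

end ATAM

/-!
The system grows a row of gadgets. In each gadget two arms race, and the winner claims a common
cell, which yields one random outcome. The tiles of the two arms have the same types up to their
order, and so the slowest step of both arms has the same concentration: whatever the concentrations
are, each arm wins with probability at least `2⁻¹ ^ 12`. The bias is unknown but the same for all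
gadgets, so von Neumann's extractor turns pairs of outcomes into independent fair bits, each after a
bounded expected number of gadgets. From `k` bits, where `2 ^ (k - 1) ≤ n < 2 ^ k`, rejection
sampling makes a uniform number below `n`. The glues along the row carry the state of this
procedure, and `O(k)` states suffice as only the comparison of the bits with `n` matters.

A potential, that is, a superharmonic function on the states of the chain, bounds the expected space
and shows that the process terminates almost surely. Another one bounds the probability of each
number by `1 / n`, and equality follows since the probabilities add up to `1`.
-/

namespace ATAM

section Bonds

/-- A side of a unit square. Quantifying over sides avoids treating the four cases of `bond`
separately. -/
inductive Side
  | north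
  | east
  | south
  | west
  deriving DecidableEq

/-- The step to the neighbour across a side. -/
def Side.offset : Side → ℤ × ℤ
  | north => (0, 1)
  | east => (1, 0)
  | south => (0, -1)
  | west => (-1, 0)

/-- The side of a neighbour that abuts the given side. -/
def Side.opposite : Side → Side
  | north => south
  | east => west
  | south => north
  | west => east

/-- The glue on a side of a tile. -/
def Tile.glue {G : Type} (t : Tile G) : Side → G
  | .north => t.north
  | .east => t.east
  | .south => t.south
  | .west => t.west

@[simp]
theorem Side.opposite_opposite (d : Side) : d.opposite.opposite = d := by
  cases d <;> rfl

@[simp]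
theorem Side.offset_opposite (d : Side) : d.opposite.offset = -d.offset := by
  cases d <;> rfl

variable {G : Type} {str : G → ℕ} {a b : PlacedTile G}

theorem bond_of_pos_eq [DecidableEq G] {d : Side} (h : b.pos = a.pos + d.offset) :
    bond str a b =
      if a.tile.glue d = b.tile.glue d.opposite then str (a.tile.glue d) else 0 := by
  unfold bond
  rw [h]
  cases d <;> simp [Side.offset, Side.opposite, Tile.glue] <;> congr

theorem bond_of_forall_pos_ne (h : ∀ d : Side, b.pos ≠ a.pos + d.offset) : bond str a b = 0 := by
  have hn := h .north
  have he := h .east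
  have hs := h .south
  have hw := h .west
  simp only [Side.offset] at hn he hs hw
  simp [bond, hn, he, hs, hw]

theorem exists_side_of_bond_ne_zero (h : bond str a b ≠ 0) :
    ∃ d : Side, b.pos = a.pos + d.offset ∧ a.tile.glue d = b.tile.glue d.opposite ∧
      bond str a b = str (a.tile.glue d) := by
  obtain ⟨d, hd⟩ : ∃ d : Side, b.pos = a.pos + d.offset := by
    by_contra! hne
    exact h (bond_of_forall_pos_ne hne)
  classical
  rw [bond_of_pos_eq hd] at h ⊢
  by_cases hg : a.tile.glue d = b.tile.glue d.opposite
  · exact ⟨d, hd, hg, if_pos hg⟩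
  · exact absurd (if_neg hg) h

theorem bond_comm (str : G → ℕ) (a b : PlacedTile G) : bond str a b = bond str b a := by
  classical
  by_cases h : ∃ d : Side, b.pos = a.pos + d.offset
  · obtain ⟨d, hd⟩ := h
    have hd' : a.pos = b.pos + d.opposite.offset := by simp [hd]
    rw [bond_of_pos_eq hd, bond_of_pos_eq hd', Side.opposite_opposite]
    by_cases hg : a.tile.glue d = b.tile.glue d.opposite
    · rw [if_pos hg, if_pos hg.symm, hg]
    · rw [if_neg hg, if_neg (Ne.symm hg)]
  · have h' (d : Side) : a.pos ≠ b.pos + d.offset := fun hd ↦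
      h ⟨d.opposite, by simp [hd]⟩
    rw [bond_of_forall_pos_ne (not_exists.1 h), bond_of_forall_pos_ne h']

end Bonds

section Stability

variable {G : Type} {str : G → ℕ} {τ : ℕ} {A B : Assembly G} {b : PlacedTile G}

open Classical in
theorem Assembly.Stable.le_sum_bond (hB : B.Stable str τ) (hb : b ∉ A.tiles)
    (hAB : B.tiles = insert b A.tiles) (hA : A.tiles.Nonempty) :
    τ ≤ ∑ a ∈ A.tiles, bond str a b := by
  have hne : {b} ≠ B.tiles := by
    obtain ⟨a, ha⟩ := hA
    rintro h
    have hab : a ∈ ({b} : Finset (PlacedTile G)) := by simp [h, hAB, ha]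
    exact hb (Finset.mem_singleton.1 hab ▸ ha)
  have hcut := hB {b} (by simp [hAB]) (Finset.singleton_nonempty b) hne
  rw [Finset.sum_singleton, hAB, Finset.sdiff_singleton_eq_erase, Finset.erase_insert hb] at hcut
  simpa only [bond_comm str b] using hcut

open Classical in
theorem Assembly.Stable.of_le_sum_bond (hA : A.Stable str τ) (hAB : B.tiles = insert b A.tiles)
    (h : τ ≤ ∑ a ∈ A.tiles, bond str a b) : B.Stable str τ := by
  intro S hSB hS hS'
  have cut_mono {X Y : Finset (PlacedTile G)} (hX : X ⊆ S) (hY : Y ⊆ B.tiles \ S) :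
      ∑ x ∈ X, ∑ y ∈ Y, bond str x y ≤ ∑ x ∈ S, ∑ y ∈ B.tiles \ S, bond str x y :=
    (Finset.sum_le_sum_of_subset hX).trans
      (Finset.sum_le_sum fun _ _ ↦ Finset.sum_le_sum_of_subset hY)
  have hABsub : A.tiles ⊆ B.tiles := hAB ▸ Finset.subset_insert b A.tiles
  rcases (S ∩ A.tiles).eq_empty_or_nonempty with hempty | hne
  · have hSA : Disjoint S A.tiles := Finset.disjoint_iff_inter_eq_empty.2 hempty
    have hbS : b ∈ S := by
      obtain ⟨x, hx⟩ := hS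
      rcases Finset.mem_insert.1 (hAB ▸ hSB hx) with rfl | hxA
      · exact hx
      · exact absurd hxA (Finset.disjoint_left.1 hSA hx)
    calc τ ≤ ∑ x ∈ {b}, ∑ y ∈ A.tiles, bond str x y := by
            simpa only [Finset.sum_singleton, bond_comm str b] using h
      _ ≤ _ := cut_mono (by simpa using hbS) (Finset.subset_sdiff.2 ⟨hABsub, hSA.symm⟩)
  · by_cases hAS : A.tiles ⊆ S
    · have hbS : b ∉ S := fun hbS ↦
        hS' (hSB.antisymm (hAB ▸ Finset.insert_subset hbS hAS))
      calc τ ≤ ∑ x ∈ A.tiles, ∑ y ∈ {b}, bond str x y := by simpa using h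
        _ ≤ _ := cut_mono hAS (by simp [hAB, hbS])
    · exact (hA _ Finset.inter_subset_right hne (mt Finset.inter_eq_right.1 hAS)).trans
        (cut_mono Finset.inter_subset_left fun x hx ↦ by
          simp only [Finset.mem_sdiff, Finset.mem_inter, not_and'] at hx ⊢
          exact ⟨hABsub hx.1, hx.2 hx.1⟩)

end Stability

section Chain

variable {G S : Type} {Γ : TileSystem G}

/-- Reachability in the transition system on `S` in which `next s` lists the possible attachments
in the state `s` together with the states that they lead to. -/
def Reach (next : S → List (PlacedTile G × S)) : S → S → Prop :=
  Relation.ReflTransGen fun s t ↦ ∃ b, (b, t) ∈ next s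

/-- The transition system `next`, started in `s₀`, is an explicit copy of the assembly process of
`Γ`: the state `s` stands for the assembly `asm s`. Different states may stand for the same
assembly, so that a state can remember how the assembly grew. -/
structure Represents (Γ : TileSystem G) (asm : S → Assembly G)
    (next : S → List (PlacedTile G × S)) (s₀ : S) : Prop where
  seed : asm s₀ = Γ.seed
  attaches {s : S} : Reach next s₀ s → ∀ e ∈ next s, Γ.Attaches (asm s) e.1 (asm e.2)
  frontier {s : S} : Reach next s₀ s → ∀ b ∈ Γ.frontier (asm s), ∃ t, (b, t) ∈ next s
  nodup {s : S} : Reach next s₀ s → ((next s).map Prod.fst).Nodup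

variable {asm : S → Assembly G} {next : S → List (PlacedTile G × S)} {s₀ s t : S}

theorem Reach.tail (h : Reach next s₀ s) {e : PlacedTile G × S} (he : e ∈ next s) :
    Reach next s₀ e.2 :=
  Relation.ReflTransGen.tail h ⟨e.1, he⟩

theorem Reach.head {e : PlacedTile G × S} (he : e ∈ next s) (h : Reach next e.2 t) :
    Reach next s t :=
  Relation.ReflTransGen.head ⟨e.1, he⟩ h

namespace Represents

theorem asm_eq_of_attaches (hR : Represents Γ asm next s₀) (hs : Reach next s₀ s)
    {e : PlacedTile G × S} (he : e ∈ next s) {B : Assembly G} (hB : Γ.Attaches (asm s) e.1 B) :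
    asm e.2 = B :=
  Assembly.ext ((hR.attaches hs e he).2.2.1.trans hB.2.2.1.symm)

theorem space_eq_add_one (hR : Represents Γ asm next s₀) (hs : Reach next s₀ s)
    {e : PlacedTile G × S} (he : e ∈ next s) : (asm e.2).space = (asm s).space + 1 := by
  classical
  obtain ⟨-, hnot, hins, -⟩ := hR.attaches hs e he
  rw [Assembly.space, hins, Finset.card_insert_of_notMem hnot, Assembly.space]

theorem grows (hR : Represents Γ asm next s₀) (hs : Reach next s₀ s) (h : Reach next s t) :
    Γ.Grows (asm s) (asm t) := by
  induction h with
  | refl => exact .refl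
  | tail hsu hut ih =>
    obtain ⟨b, hb⟩ := hut
    exact ih.tail ⟨b, hR.attaches (hs.trans hsu) _ hb⟩

theorem mem_producible (hR : Represents Γ asm next s₀) (hs : Reach next s₀ s) :
    asm s ∈ Γ.producible := by
  have h := hR.grows .refl hs
  rwa [hR.seed] at h

theorem exists_reach_of_mem_producible (hR : Represents Γ asm next s₀) {A : Assembly G}
    (hA : A ∈ Γ.producible) : ∃ s, Reach next s₀ s ∧ asm s = A := by
  induction hA with
  | refl => exact ⟨s₀, .refl, hR.seed⟩
  | tail _ h ih =>
    obtain ⟨t, ht, rfl⟩ := ih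
    obtain ⟨b, hb⟩ := h
    obtain ⟨u, hu⟩ := hR.frontier ht b ⟨_, hb⟩
    exact ⟨u, ht.tail hu, hR.asm_eq_of_attaches ht hu hb⟩

theorem frontier_eq_empty_iff (hR : Represents Γ asm next s₀) (hs : Reach next s₀ s) :
    Γ.frontier (asm s) = ∅ ↔ next s = [] := by
  rw [Set.eq_empty_iff_forall_notMem, List.eq_nil_iff_forall_not_mem]
  constructor
  · exact fun h e he ↦ h e.1 ⟨_, hR.attaches hs e he⟩
  · intro h b hb
    obtain ⟨t, ht⟩ := hR.frontier hs b hb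
    exact h _ ht

theorem mem_terminal_iff (hR : Represents Γ asm next s₀) (hs : Reach next s₀ s) :
    asm s ∈ Γ.terminal ↔ next s = [] := by
  rw [← hR.frontier_eq_empty_iff hs]
  exact ⟨fun h ↦ h.2, fun h ↦ ⟨hR.mem_producible hs, h⟩⟩

theorem extensible (hR : Represents Γ asm next s₀) {k : ℕ}
    (hk : ∀ s, Reach next s₀ s → (next s).length ≤ k) : Γ.Extensible k := by
  classical
  intro A hA
  obtain ⟨s, hs, rfl⟩ := hR.exists_reach_of_mem_producible hA
  have hsub : PlacedTile.pos '' Γ.frontier (asm s) ⊆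
      (((next s).map fun e ↦ e.1.pos).toFinset : Set (ℤ × ℤ)) := by
    rintro _ ⟨b, hb, rfl⟩
    obtain ⟨t, ht⟩ := hR.frontier hs b hb
    exact List.mem_toFinset.2 (List.mem_map.2 ⟨_, ht, rfl⟩)
  calc (PlacedTile.pos '' Γ.frontier (asm s)).encard
      ≤ ((next s).map fun e ↦ e.1.pos).toFinset.card := by
        simpa only [Set.encard_coe_eq_coe_finsetCard] using Set.encard_le_encard hsub
    _ ≤ ((next s).map fun e ↦ e.1.pos).length := Nat.cast_le.2 (List.toFinset_card_le _)
    _ ≤ k := by simpa using hk s hs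

end Represents

/-- One step of the Markov chain on states, acting on functions: the value of
`meanNext P next f` in `s` is the mean of `f` over the successors of `s`, weighted by the
concentrations of the attaching tiles. It is `0` if there are none. -/
noncomputable def meanNext (P : Concentration Γ.tileSet) (next : S → List (PlacedTile G × S)) :
    Module.End ℝ≥0∞ (S → ℝ≥0∞) where
  toFun f s := ((next s).map fun e ↦ (P.conc e.1.tile : ℝ≥0∞) /
    ((next s).map fun e ↦ (P.conc e.1.tile : ℝ≥0∞)).sum * f e.2).sum
  map_add' f g := by
    funext s
    simp only [Pi.add_apply, mul_add, List.sum_map_add]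
  map_smul' c f := by
    funext s
    simp only [Pi.smul_apply, smul_eq_mul, RingHom.id_apply, mul_left_comm _ c,
      List.sum_map_mul_left]

variable (P : Concentration Γ.tileSet) {f g : S → ℝ≥0∞}

theorem meanNext_apply (f : S → ℝ≥0∞) (s : S) :
    meanNext P next f s = ((next s).map fun e ↦ (P.conc e.1.tile : ℝ≥0∞) /
      ((next s).map fun e ↦ (P.conc e.1.tile : ℝ≥0∞)).sum * f e.2).sum :=
  rfl

theorem meanNext_eq_zero (hs : next s = []) : meanNext P next f s = 0 := by
  simp [meanNext_apply, hs]

theorem meanNext_mono (h : ∀ e ∈ next s, f e.2 ≤ g e.2) :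
    meanNext P next f s ≤ meanNext P next g s :=
  List.sum_le_sum fun e he ↦ mul_le_mul_right (h e he) _

theorem meanNext_pow_mono (k : ℕ) (h : ∀ t, Reach next s t → f t ≤ g t) :
    (meanNext P next ^ k) f s ≤ (meanNext P next ^ k) g s := by
  induction k generalizing s with
  | zero => exact h s .refl
  | succ k ih =>
    rw [pow_succ', Module.End.mul_apply, Module.End.mul_apply]
    exact meanNext_mono P fun e he ↦ ih fun t ht ↦ h t (ht.head he)

theorem meanNext_pow_congr (k : ℕ) (h : ∀ t, Reach next s t → f t = g t) :
    (meanNext P next ^ k) f s = (meanNext P next ^ k) g s :=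
  (meanNext_pow_mono P k fun t ht ↦ (h t ht).le).antisymm
    (meanNext_pow_mono P k fun t ht ↦ (h t ht).ge)

theorem meanNext_pow_const_mul (c : ℝ≥0∞) (k : ℕ) (s : S) :
    (meanNext P next ^ k) (fun t ↦ c * f t) s = c * (meanNext P next ^ k) f s :=
  congrFun ((meanNext P next ^ k).map_smul c f) s

theorem tsum_list_sum {ι E : Type} (l : List E) (F : ι → E → ℝ≥0∞) :
    ∑' i, (l.map (F i)).sum = (l.map fun e ↦ ∑' i, F i e).sum := by
  induction l with
  | nil => simp
  | cons a l ih => simp only [List.map_cons, List.sum_cons, ENNReal.tsum_add, ih]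

theorem meanNext_pow_tsum {ι : Type} (F : ι → S → ℝ≥0∞) (k : ℕ) (s : S) :
    (meanNext P next ^ k) (fun s ↦ ∑' i, F i s) s = ∑' i, (meanNext P next ^ k) (F i) s := by
  induction k generalizing s with
  | zero => rfl
  | succ k ih =>
    simp only [pow_succ', Module.End.mul_apply, meanNext_apply, ih, tsum_list_sum,
      ENNReal.tsum_mul_left]

theorem meanNext_one (hT : ∀ e ∈ next s, e.1.tile ∈ Γ.tileSet) (hs : next s ≠ []) :
    meanNext P next 1 s = 1 := by
  set weights := (next s).map fun e ↦ (P.conc e.1.tile : ℝ≥0∞)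
  have hne : weights.sum ≠ 0 := by
    obtain ⟨e, he⟩ := List.exists_mem_of_ne_nil _ hs
    have hpos : (P.conc e.1.tile : ℝ≥0∞) ≠ 0 := ENNReal.coe_ne_zero.2 (P.conc_pos _ (hT e he)).ne'
    exact fun h ↦ hpos (List.sum_eq_zero_iff.1 h _ (List.mem_map_of_mem he))
  have htop : weights.sum ≠ ⊤ := by
    simp only [weights]
    induction next s with
    | nil => simp
    | cons e l ih => simpa using ih
  calc meanNext P next 1 s = weights.sum * weights.sum⁻¹ := by
        simp only [meanNext_apply, div_eq_mul_inv, Pi.one_apply, mul_one, List.sum_map_mul_right,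
          weights]
    _ = 1 := ENNReal.mul_inv_cancel hne htop

theorem meanNext_le (hT : ∀ e ∈ next s, e.1.tile ∈ Γ.tileSet) {c : ℝ≥0∞}
    (h : ∀ e ∈ next s, f e.2 ≤ c) : meanNext P next f s ≤ c := by
  rcases eq_or_ne (next s) [] with hs | hs
  · simp [meanNext_eq_zero P hs]
  · calc meanNext P next f s
        ≤ meanNext P next (c • (1 : S → ℝ≥0∞)) s :=
          meanNext_mono P fun e he ↦ by simpa using h e he
      _ = c := by rw [map_smul, Pi.smul_apply, meanNext_one P hT hs, smul_eq_mul, mul_one]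

theorem exists_reach_of_meanNext_pow_ne_zero {k : ℕ} (h : (meanNext P next ^ k) f s ≠ 0) :
    ∃ t, Reach next s t ∧ f t ≠ 0 := by
  by_contra! hzero
  have := meanNext_pow_congr P k (g := 0) hzero
  exact h (by rw [this, map_zero, Pi.zero_apply])

/-- A superharmonic function `f`, with drop at least `g`, dominates the total expected reward. -/
theorem tsum_meanNext_pow_le (h : ∀ t, Reach next s t → meanNext P next f t + g t ≤ f t) :
    ∑' k, (meanNext P next ^ k) g s ≤ f s := by
  have partial_le (K : ℕ) : ∑ k ∈ Finset.range K, (meanNext P next ^ k) g s +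
      (meanNext P next ^ K) f s ≤ f s := by
    induction K with
    | zero => simp
    | succ K ih =>
      refine le_trans ?_ ih
      rw [Finset.sum_range_succ, add_assoc, pow_succ, Module.End.mul_apply]
      gcongr
      rw [← Pi.add_apply, ← map_add, add_comm g]
      exact meanNext_pow_mono P K h
  rw [ENNReal.tsum_eq_iSup_nat]
  exact iSup_le fun K ↦ le_self_add.trans (partial_le K)

end Chain

section Termination

variable {G S : Type} {Γ : TileSystem G} {asm : S → Assembly G}
  {next : S → List (PlacedTile G × S)} {s₀ s : S} {f : S → ℝ≥0∞}

theorem tsum_coe_eq_list_sum {E : Type} {T : Set (PlacedTile G)} (l : List E)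
    (φ : E → PlacedTile G) (hl : (l.map φ).Nodup) (hT : ∀ b, b ∈ T ↔ ∃ e ∈ l, φ e = b)
    (w : PlacedTile G → ℝ≥0∞) : ∑' b : T, w b = (l.map fun e ↦ w (φ e)).sum := by
  classical
  obtain rfl : T = ((l.map φ).toFinset : Set (PlacedTile G)) := by
    ext b
    simp [hT]
  rw [Finset.tsum_subtype' (l.map φ).toFinset w, List.sum_toFinset _ hl, List.map_map]
  rfl

namespace Represents

theorem tsum_frontier (hR : Represents Γ asm next s₀) (hs : Reach next s₀ s)
    (w : PlacedTile G → ℝ≥0∞) :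
    ∑' b : Γ.frontier (asm s), w b = ((next s).map fun e ↦ w e.1).sum := by
  refine tsum_coe_eq_list_sum (next s) Prod.fst (hR.nodup hs) (fun b ↦ ⟨fun hb ↦ ?_, ?_⟩) w
  · obtain ⟨t, ht⟩ := hR.frontier hs b hb
    exact ⟨_, ht, rfl⟩
  · rintro ⟨e, he, rfl⟩
    exact ⟨_, hR.attaches hs e he⟩

open Classical in
theorem tsum_attaches (hR : Represents Γ asm next s₀) (hs : Reach next s₀ s)
    (w : PlacedTile G → ℝ≥0∞) (B : Assembly G) :
    ∑' b : {b | Γ.Attaches (asm s) b B}, w b =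
      ((next s).map fun e ↦ if asm e.2 = B then w e.1 else 0).sum := by
  rw [tsum_coe_eq_list_sum ((next s).filter fun e ↦ asm e.2 = B) Prod.fst
    ((hR.nodup hs).sublist (List.filter_sublist.map _)) (fun b ↦ ⟨fun hb ↦ ?_, ?_⟩) w]
  · rw [List.sum_map_ite]
    simp
  · obtain ⟨t, ht⟩ := hR.frontier hs b ⟨B, hb⟩
    exact ⟨(b, t), by simpa [ht] using hR.asm_eq_of_attaches hs ht hb, rfl⟩
  · rintro ⟨e, he, rfl⟩
    simp only [List.mem_filter, decide_eq_true_eq] at he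
    exact he.2 ▸ hR.attaches hs e he.1

variable (P : Concentration Γ.tileSet)

open Classical in
theorem trans_eq (hR : Represents Γ asm next s₀) (hs : Reach next s₀ s) (B : Assembly G) :
    TileSystem.trans P (asm s) B = meanNext P next (fun t ↦ if asm t = B then 1 else 0) s := by
  rw [TileSystem.trans, hR.tsum_frontier hs fun b ↦ (P.conc b.tile : ℝ≥0∞),
    hR.tsum_attaches hs fun b ↦ (P.conc b.tile : ℝ≥0∞)]
  simp only [meanNext_apply, div_eq_mul_inv, ← List.sum_map_mul_right, ite_mul, zero_mul,
    mul_ite, mul_one, mul_zero]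

open Classical in
theorem law_eq (hR : Represents Γ asm next s₀) (k : ℕ) (A : Assembly G) :
    TileSystem.law P k A = (meanNext P next ^ k) (fun t ↦ if asm t = A then 1 else 0) s₀ := by
  induction k generalizing A with
  | zero => simp [TileSystem.law, hR.seed, eq_comm]
  | succ k ih =>
    calc TileSystem.law P (k + 1) A
        = ∑' B, (meanNext P next ^ k)
            (fun t ↦ TileSystem.trans P B A * if asm t = B then 1 else 0) s₀ := by
          simp only [TileSystem.law, ih, meanNext_pow_const_mul]
          simp only [mul_comm]
      _ = (meanNext P next ^ k) (fun t ↦ TileSystem.trans P (asm t) A) s₀ := by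
          rw [← meanNext_pow_tsum]
          refine meanNext_pow_congr P k fun t _ ↦ ?_
          rw [tsum_eq_single (asm t) fun B hB ↦ by simp [hB.symm]]
          simp
      _ = (meanNext P next ^ (k + 1)) (fun t ↦ if asm t = A then 1 else 0) s₀ := by
          rw [pow_succ, Module.End.mul_apply]
          exact meanNext_pow_congr P k fun t ht ↦ hR.trans_eq P ht A

theorem tsum_mul_probTerm (hR : Represents Γ asm next s₀) (X : Set (Assembly G))
    (w : Assembly G → ℝ≥0∞) :
    ∑' A : X, w A * TileSystem.probTerm P A.1 =
      ∑' k, (meanNext P next ^ k) (fun t ↦ X.indicator w (asm t)) s₀ := by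
  classical
  simp only [TileSystem.probTerm, ← ENNReal.tsum_mul_left]
  rw [ENNReal.tsum_comm]
  congr 1
  funext k
  simp only [hR.law_eq P k, ← meanNext_pow_const_mul]
  rw [← meanNext_pow_tsum]
  refine meanNext_pow_congr P k fun t _ ↦ ?_
  rw [tsum_subtype X fun A ↦ w A * if asm t = A then 1 else 0, tsum_eq_single (asm t)]
  · by_cases h : asm t ∈ X <;> simp [h]
  · intro B hB
    by_cases h : B ∈ X <;> simp [h, hB.symm]

theorem probOf_eq (hR : Represents Γ asm next s₀) (X : Set (Assembly G)) :
    TileSystem.probOf P X = ∑' k, (meanNext P next ^ k) ((asm ⁻¹' X).indicator 1) s₀ := by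
  have h := hR.tsum_mul_probTerm P X 1
  simp only [Pi.one_apply, one_mul] at h
  exact h

theorem probOf_le (hR : Represents Γ asm next s₀) {X : Set (Assembly G)} (hX : X ⊆ Γ.terminal)
    (hf : ∀ s, Reach next s₀ s → asm s ∈ X → 1 ≤ f s)
    (hstep : ∀ s, Reach next s₀ s → next s ≠ [] → meanNext P next f s ≤ f s) :
    TileSystem.probOf P X ≤ f s₀ := by
  rw [hR.probOf_eq]
  refine tsum_meanNext_pow_le P fun s hs ↦ ?_
  by_cases hsX : asm s ∈ X
  · rw [meanNext_eq_zero P ((hR.mem_terminal_iff hs).1 (hX hsX)), zero_add]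
    simpa [hsX] using hf s hs hsX
  · rcases eq_or_ne (next s) [] with hn | hn
    · simp [meanNext_eq_zero P hn, hsX]
    · simpa [hsX] using hstep s hs hn

/-- A function that drops by one in every step bounds the expected number of steps; if that is
finite, the process ends almost surely. -/
theorem tsum_meanNext_pow_halted (hR : Represents Γ asm next s₀) (hs : Reach next s₀ s)
    (hf : f s ≠ ⊤) (hstep : ∀ t, Reach next s₀ t → next t ≠ [] → meanNext P next f t + 1 ≤ f t) :
    ∑' k, (meanNext P next ^ k) ({t | next t = []}.indicator 1) s = 1 := by
  set halted : S → ℝ≥0∞ := {t | next t = []}.indicator 1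
  set running : S → ℝ≥0∞ := {t | next t = []}ᶜ.indicator 1
  have hsum : halted + running = 1 := Set.indicator_self_add_compl _ _
  have hmean (t : S) (ht : Reach next s₀ t) : meanNext P next 1 t = running t := by
    by_cases hn : next t = []
    · simp [running, hn, meanNext_eq_zero P hn]
    · rw [meanNext_one P (fun e he ↦ (hR.attaches ht e he).1) hn]
      simp [running, hn]
  have hrunning : ∑' k, (meanNext P next ^ k) running s ≠ ⊤ := by
    refine ne_top_of_le_ne_top hf (tsum_meanNext_pow_le P fun t ht ↦ ?_)
    by_cases hn : next t = []
    · simp [running, hn, meanNext_eq_zero P hn]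
    · simpa [running, hn] using hstep t (hs.trans ht) hn
  have hpow (K : ℕ) : (meanNext P next ^ (K + 1)) 1 s = (meanNext P next ^ K) running s := by
    rw [pow_succ, Module.End.mul_apply]
    exact meanNext_pow_congr P K fun t ht ↦ hmean t (hs.trans ht)
  have hpartial (K : ℕ) : ∑ k ∈ Finset.range K, (meanNext P next ^ k) halted s +
      (meanNext P next ^ K) 1 s = 1 := by
    induction K with
    | zero => simp
    | succ K ih =>
      rw [Finset.sum_range_succ, add_assoc, hpow, ← Pi.add_apply, ← map_add, hsum, ih]
  have hlim : Filter.Tendsto (fun K ↦ (meanNext P next ^ K) 1 s) Filter.atTop (nhds 0) := by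
    rw [← Filter.tendsto_add_atTop_iff_nat 1]
    simpa only [hpow] using ENNReal.tendsto_atTop_zero_of_tsum_ne_top hrunning
  have hsums := (ENNReal.tendsto_nat_tsum fun k ↦ (meanNext P next ^ k) halted s).add hlim
  simp only [hpartial, add_zero] at hsums
  exact tendsto_nhds_unique hsums tendsto_const_nhds

theorem probOf_terminal (hR : Represents Γ asm next s₀) (hf : f s₀ ≠ ⊤)
    (hstep : ∀ t, Reach next s₀ t → next t ≠ [] → meanNext P next f t + 1 ≤ f t) :
    TileSystem.probOf P Γ.terminal = 1 := by
  rw [hR.probOf_eq, ← hR.tsum_meanNext_pow_halted P .refl hf hstep]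
  congr 1
  funext k
  refine meanNext_pow_congr P k fun t ht ↦ Set.indicator_eq_indicator ?_ rfl
  exact hR.mem_terminal_iff ht

theorem isFinite (hR : Represents Γ asm next s₀) (hf : ∀ s, f s ≠ ⊤)
    (hstep : ∀ t, Reach next s₀ t → next t ≠ [] → meanNext P next f t + 1 ≤ f t) :
    Γ.IsFinite := by
  intro B hB
  obtain ⟨s, hs, rfl⟩ := hR.exists_reach_of_mem_producible hB
  obtain ⟨k, hk⟩ : ∃ k, (meanNext P next ^ k) ({t | next t = []}.indicator 1) s ≠ 0 := by
    by_contra! hzero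
    simpa [hzero] using hR.tsum_meanNext_pow_halted P hs (hf s) hstep
  obtain ⟨t, ht, hne⟩ := exists_reach_of_meanNext_pow_ne_zero P hk
  have hn : t ∈ {t | next t = []} := Set.mem_of_indicator_ne_zero hne
  exact ⟨asm t, (hR.mem_terminal_iff (hs.trans ht)).2 hn, hR.grows hs ht⟩

theorem expectedSpace_le (hR : Represents Γ asm next s₀)
    (hstep : ∀ t, Reach next s₀ t → next t ≠ [] → meanNext P next f t + 1 ≤ f t) :
    TileSystem.expectedSpace P ≤ f s₀ + Γ.seed.space := by
  set space : S → ℝ≥0∞ := fun s ↦ (asm s).space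
  have hspace (s : S) (hs : Reach next s₀ s) : meanNext P next space s ≤ space s + 1 :=
    meanNext_le P (fun e he ↦ (hR.attaches hs e he).1) fun e he ↦ by
      simp [space, hR.space_eq_add_one hs he]
  rw [← hR.seed]
  refine (hR.tsum_mul_probTerm P Γ.terminal fun A ↦ (A.space : ℝ≥0∞)).trans_le
    (tsum_meanNext_pow_le P (f := f + space) fun s hs ↦ ?_)
  by_cases hn : next s = []
  · simp [meanNext_eq_zero P hn, (hR.mem_terminal_iff hs).2 hn, space]
  · rw [Set.indicator_of_notMem (mt (hR.mem_terminal_iff hs).1 hn), add_zero, map_add,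
      Pi.add_apply, Pi.add_apply]
    calc meanNext P next f s + meanNext P next space s
        ≤ meanNext P next f s + (space s + 1) := by gcongr; exact hspace s hs
      _ = meanNext P next f s + 1 + space s := by ring
      _ ≤ f s + space s := by gcongr; exact hstep s hs hn

end Represents

/-- The uniform concentration distribution. -/
noncomputable def Concentration.uniform {T : Finset (Tile G)} (hT : T.Nonempty) :
    Concentration T where
  conc _ := (T.card : ℝ≥0)⁻¹
  conc_pos _ _ := inv_pos.2 (Nat.cast_pos.2 hT.card_pos)
  conc_sum := by
    rw [Finset.sum_const, nsmul_eq_mul, mul_inv_cancel₀ (Nat.cast_ne_zero.2 hT.card_pos.ne')]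

end Termination

section Attachable

variable {G : Type} [DecidableEq G]

instance : DecidableEq (Tile G) := fun s t ↦
  decidable_of_iff (s.north = t.north ∧ s.east = t.east ∧ s.south = t.south ∧ s.west = t.west ∧
    s.label = t.label) (by cases s; cases t; simp)

instance : DecidableEq (PlacedTile G) := fun a b ↦
  decidable_of_iff (a.pos = b.pos ∧ a.tile = b.tile) (by cases a; cases b; simp [and_comm])

/-- An executable copy of `bond`, for the finite checks on a single gadget. -/
def decBond (str : G → ℕ) (a b : PlacedTile G) : ℕ :=
  if b.pos = a.pos + (1, 0) ∧ a.tile.east = b.tile.west then str a.tile.east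
  else if b.pos = a.pos + (-1, 0) ∧ a.tile.west = b.tile.east then str a.tile.west
  else if b.pos = a.pos + (0, 1) ∧ a.tile.north = b.tile.south then str a.tile.north
  else if b.pos = a.pos + (0, -1) ∧ a.tile.south = b.tile.north then str a.tile.south
  else 0

theorem decBond_eq_bond : decBond (G := G) = bond := by
  funext str a b
  simp only [decBond, bond]
  congr

/-- The placed tiles of types in `T` that bond to `l` with total strength at least `τ`, found by
trying the free neighbours of `l` across sides with a glue of positive strength. -/
def attachable (str : G → ℕ) (τ : ℕ) (T : List (Tile G)) (l : List (PlacedTile G)) :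
    List (PlacedTile G) :=
  l.flatMap fun u ↦ [Side.north, .east, .south, .west].flatMap fun d ↦
    if str (u.tile.glue d) = 0 ∨ u.pos + d.offset ∈ l.map PlacedTile.pos then []
    else ((T.filter fun t ↦ t.glue d.opposite = u.tile.glue d).map
      fun t ↦ ⟨t, u.pos + d.offset⟩).filter fun b ↦ τ ≤ (l.map fun a ↦ decBond str a b).sum

theorem mem_attachable {str : G → ℕ} {τ : ℕ} {T : List (Tile G)} {l : List (PlacedTile G)}
    {b : PlacedTile G} (hτ : 0 < τ) (hT : b.tile ∈ T) (hfree : ∀ a ∈ l, a.pos ≠ b.pos)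
    (hb : τ ≤ (l.map fun a ↦ bond str a b).sum) : b ∈ attachable str τ T l := by
  obtain ⟨u, hu, hne⟩ : ∃ u ∈ l, bond str u b ≠ 0 := by
    by_contra! hzero
    rw [List.sum_eq_zero fun n hn ↦ by obtain ⟨u, hu, rfl⟩ := List.mem_map.1 hn; exact hzero u hu]
      at hb
    omega
  obtain ⟨d, hd, hg, hstr⟩ := exists_side_of_bond_ne_zero hne
  refine List.mem_flatMap.2 ⟨u, hu, List.mem_flatMap.2 ⟨d, by cases d <;> simp, ?_⟩⟩
  have hfree' : ¬(str (u.tile.glue d) = 0 ∨ u.pos + d.offset ∈ l.map PlacedTile.pos) := by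
    rintro (h | h)
    · exact hne (hstr.trans h)
    · obtain ⟨v, hv, hpos⟩ := List.mem_map.1 h
      exact hfree v hv (hpos.trans hd.symm)
  rw [if_neg hfree', List.mem_filter, List.mem_map]
  simp only [List.mem_filter, decide_eq_true_eq, decBond_eq_bond]
  exact ⟨⟨b.tile, ⟨hT, hg.symm⟩, by rw [← hd]⟩, hb⟩

end Attachable

section Gadget

/-- The strength of a glue code. The codes below `18` do not depend on the state of the machine. -/
def codeStrength (c : ℕ) : ℕ :=
  if c = 0 then 0 else if c < 14 ∨ c = 18 then 1 else 2

/-- The strength of the glue codes that do not depend on the state of the machine. -/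
def sharedStrength (c : ℕ) : ℕ :=
  if c < 18 then codeStrength c else 0

/-- The unlabelled tile with the given glue codes at `(x, y)`. -/
def item (x y : ℤ) (north east south west : ℕ) : PlacedTile ℕ :=
  ⟨⟨north, east, south, west, default⟩, (x, y)⟩

/-- The tile (`E` in the picture below) from which a gadget grows: the seed, or the last tile of the
previous gadget. -/
def entryItem : PlacedTile ℕ :=
  item 0 6 0 26 0 0

/-- The frame `F` of the gadget that draws one random bit, in the order of its growth. Once it is
complete, the arms `L` and `R` grow towards each other, and the first one to arrive claims the place
`C`. The report `T` carries the winner to the exit `X`.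
```
  7   .  .  .  .  .  .  T  T  T  T  T  T
  6   E  F  F  F  .  .  T  F  F  F  F  X
  5   .  F  F  F  .  T  T  F  F  F  F  .
  4   .  F  L  L  L  C  R  R  R  F  F  .
  3   .  F  L  L  L  F  R  R  R  F  F  .
  2   .  F  F  F  F  F  F  F  F  F  F  .
  1   .  .  .  .  F  F  F  F  F  F  F  .
      0  1  2  3  4  5  6  7  8  9 10 11
```
This is the report of the left arm. That of the right arm passes through `(4, 5)`, `(4, 6)` and
`(5, 6)` instead of `(6, 5)`. -/
def frameItems : List (PlacedTile ℕ) :=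
  [item 1 6 0 27 0 26, item 2 6 0 28 0 27, item 3 6 0 0 29 28, item 3 5 29 0 0 30,
    item 2 5 0 30 0 31, item 1 5 0 31 32 0, item 1 4 32 6 33 0, item 1 3 33 0 34 0,
    item 1 2 34 35 0 0, item 2 2 3 36 0 35, item 3 2 3 37 0 36, item 4 2 2 0 38 37,
    item 4 1 38 39 0 0, item 5 1 0 40 0 39, item 6 1 0 41 0 40, item 7 1 0 42 0 41,
    item 8 1 0 43 0 42, item 9 1 0 44 0 43, item 10 1 45 0 0 44, item 10 2 46 0 45 0,
    item 10 3 47 0 46 0, item 10 4 48 0 47 0, item 10 5 49 0 48 0, item 10 6 0 0 49 50,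
    item 9 6 0 50 0 51, item 8 6 0 51 0 52, item 7 6 0 52 53 18, item 7 5 53 54 0 0,
    item 8 5 0 55 0 54, item 9 5 0 0 56 55, item 9 4 56 0 57 8, item 9 3 57 0 58 0,
    item 9 2 58 0 0 59, item 8 2 3 59 0 60, item 7 2 3 60 0 61, item 6 2 2 61 0 62,
    item 5 2 63 62 0 0, item 5 3 4 1 63 1]

/-- The left arm `L`. It consists of the same tile types as the right arm, in another order, and
none of them depends on the state of the machine. -/
def leftItems : List (PlacedTile ℕ) :=
  [item 4 3 5 1 2 1, item 3 3 4 1 3 1, item 2 3 4 1 3 1, item 2 4 14 7 4 6, item 3 4 15 8 4 7,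
    item 4 4 9 6 5 8]

/-- The right arm `R`. -/
def rightItems : List (PlacedTile ℕ) :=
  [item 6 3 5 1 2 1, item 7 3 4 1 3 1, item 8 3 4 1 3 1, item 8 4 15 8 4 7, item 7 4 14 7 4 6,
    item 6 4 9 6 5 8]

/-- The tiles that follow a victory of the left arm (`true`) or of the right arm (`false`): the
claim `C`, the report `T` and the exit `X`. -/
def reportItems : Bool → List (PlacedTile ℕ)
  | true =>
    [item 5 4 14 7 4 6, item 5 5 0 10 14 0, item 6 5 12 0 9 10, item 6 6 19 18 12 0,
      item 6 7 0 20 19 0, item 7 7 0 21 0 20, item 8 7 0 22 0 21, item 9 7 0 23 0 22,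
      item 10 7 0 24 0 23, item 11 7 0 0 25 24, item 11 6 25 71 0 0]
  | false =>
    [item 5 4 15 8 4 7, item 5 5 0 0 15 11, item 4 5 16 11 9 0, item 4 6 0 17 16 0,
      item 5 6 0 13 0 17, item 6 6 64 18 0 13, item 6 7 0 65 64 0, item 7 7 0 66 0 65,
      item 8 7 0 67 0 66, item 9 7 0 68 0 67, item 10 7 0 69 0 68, item 11 7 0 0 70 69,
      item 11 6 70 72 0 0]

/-- The tiles of all possible gadgets. -/
def gadgetItems : List (PlacedTile ℕ) :=
  entryItem :: (frameItems ++ leftItems ++ rightItems ++ reportItems true ++ reportItems false)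

/-- The tile types of the gadget. -/
def gadgetTiles : List (Tile ℕ) :=
  gadgetItems.map PlacedTile.tile

/-- The progress within a gadget: the numbers of tiles of the frame, of the two arms and of the
report. The winner is `true` by convention as long as there is none. -/
structure Progress where
  frame : ℕ
  left : ℕ
  right : ℕ
  winner : Bool
  report : ℕ
  deriving DecidableEq

namespace Progress

/-- The progress at the beginning of a gadget. -/
def zero : Progress :=
  ⟨0, 0, 0, true, 0⟩

/-- The progress of a complete gadget. -/
def full (o : Bool) : Progress :=
  ⟨38, 6, 6, o, (reportItems o).length⟩

/-- The tiles that are present, except for the entry. -/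
def items (σ : Progress) : List (PlacedTile ℕ) :=
  frameItems.take σ.frame ++ leftItems.take σ.left ++ rightItems.take σ.right ++
    (reportItems σ.winner).take σ.report

/-- The next attachment at the left arm: its next tile, or its claim. -/
def leftNext (σ : Progress) : PlacedTile ℕ × Progress :=
  if σ.left < 6 then (leftItems.getD σ.left entryItem, { σ with left := σ.left + 1 })
  else ((reportItems true).getD 0 entryItem, { σ with winner := true, report := 1 })

/-- The next attachment at the right arm: its next tile, or its claim. -/
def rightNext (σ : Progress) : PlacedTile ℕ × Progress :=
  if σ.right < 6 then (rightItems.getD σ.right entryItem, { σ with right := σ.right + 1 })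
  else ((reportItems false).getD 0 entryItem, { σ with winner := false, report := 1 })

/-- The next attachment at the report. -/
def reportNext (σ : Progress) : PlacedTile ℕ × Progress :=
  ((reportItems σ.winner).getD σ.report entryItem, { σ with report := σ.report + 1 })

/-- The possible attachments, with the progress after them. The second tile of the report does not
wait for the arm that has lost, but the third one does. -/
def next (σ : Progress) : List (PlacedTile ℕ × Progress) :=
  if σ.frame < 38 then [(frameItems.getD σ.frame entryItem, { σ with frame := σ.frame + 1 })]
  else if σ.report = 0 then [σ.leftNext, σ.rightNext]
  else if σ.left < 6 then
    if σ.report = 1 then [σ.reportNext, σ.leftNext] else [σ.leftNext]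
  else if σ.right < 6 then
    if σ.report = 1 then [σ.reportNext, σ.rightNext] else [σ.rightNext]
  else if σ.report < (reportItems σ.winner).length then [σ.reportNext]
  else []

/-- The progress values that occur while a gadget grows. -/
def growing : List Progress :=
  (List.range 38).map (fun p ↦ ⟨p, 0, 0, true, 0⟩) ++
  (List.range 7).flatMap (fun i ↦ (List.range 7).map fun j ↦ ⟨38, i, j, true, 0⟩) ++
  (List.range 7).flatMap (fun j ↦ [⟨38, 6, j, true, 1⟩, ⟨38, 6, j, true, 2⟩,
    ⟨38, j, 6, false, 1⟩, ⟨38, j, 6, false, 2⟩]) ++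
  (List.range' 3 8).map (fun m ↦ ⟨38, 6, 6, true, m⟩) ++
  (List.range' 3 10).map (fun m ↦ ⟨38, 6, 6, false, m⟩)

theorem zero_mem_growing : zero ∈ growing := by
  decide +kernel

theorem mem_growing_or_eq_full : ∀ σ ∈ growing, ∀ e ∈ σ.next,
    e.2 ∈ growing ∨ e.2 = full e.2.winner := by
  decide +kernel

theorem length_next_le_two : ∀ σ ∈ growing, σ.next.length ≤ 2 := by
  decide +kernel

theorem next_ne_nil : ∀ σ ∈ growing, σ.next ≠ [] := by
  decide +kernel

theorem items_perm_of_mem_next : ∀ σ ∈ growing, ∀ e ∈ σ.next,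
    e.2.items.Perm (e.1 :: σ.items) := by
  decide +kernel

theorem nodup_map_next : ∀ σ ∈ growing,
    (σ.next.map fun e ↦ (e.1.pos, e.1.tile.north)).Nodup := by
  decide +kernel

theorem mem_gadgetItems_of_mem_next : ∀ σ ∈ growing, ∀ e ∈ σ.next, e.1 ∈ gadgetItems.tail := by
  decide +kernel

theorem east_eq_zero_of_mem_growing : ∀ σ ∈ growing, ∀ u ∈ σ.items,
    u.pos.1 = 11 → u.tile.east = 0 := by
  decide +kernel

theorem free_of_mem_next : ∀ σ ∈ growing, ∀ e ∈ σ.next, ∀ u ∈ entryItem :: σ.items,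
    u.pos ≠ e.1.pos := by
  decide +kernel

theorem two_le_sum_bond_of_mem_next {σ : Progress} (hσ : σ ∈ growing)
    {e : PlacedTile ℕ × Progress} (he : e ∈ σ.next) :
    2 ≤ ((entryItem :: σ.items).map fun u ↦ bond codeStrength u e.1).sum := by
  have check : ∀ σ ∈ growing, ∀ e ∈ σ.next,
      2 ≤ ((entryItem :: σ.items).map fun u ↦ decBond codeStrength u e.1).sum := by
    decide +kernel
  simpa only [decBond_eq_bond] using check σ hσ e he

/-- A tile that can attach by its shared glues alone has no other glues. -/
theorem glue_lt_of_two_le_sum_sharedStrength {σ : Progress} (hσ : σ ∈ growing)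
    {e : PlacedTile ℕ × Progress} (he : e ∈ σ.next)
    (h : 2 ≤ ((entryItem :: σ.items).map fun u ↦ bond sharedStrength u e.1).sum) (d : Side) :
    e.1.tile.glue d < 18 := by
  have check : ∀ σ ∈ growing, ∀ e ∈ σ.next,
      2 ≤ ((entryItem :: σ.items).map fun u ↦ decBond sharedStrength u e.1).sum →
        ∀ d ∈ [Side.north, .east, .south, .west], e.1.tile.glue d < 18 := by
    decide +kernel
  simp only [decBond_eq_bond] at check
  exact check σ hσ e he h d (by cases d <;> simp)

set_option maxHeartbeats 400000 in
-- the kernel tries every tile type at every free place next to every growing gadget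
theorem exists_mem_next_of_two_le_sum_bond {σ : Progress} (hσ : σ ∈ growing) {b : PlacedTile ℕ}
    (hb : b.tile ∈ gadgetTiles) (hfree : ∀ u ∈ entryItem :: σ.items, u.pos ≠ b.pos)
    (h : 2 ≤ ((entryItem :: σ.items).map fun u ↦ bond codeStrength u b).sum) :
    ∃ e ∈ σ.next, e.1 = b := by
  have check : ∀ σ ∈ growing,
      ∀ b ∈ attachable codeStrength 2 gadgetTiles (entryItem :: σ.items),
        b ∈ σ.next.map Prod.fst := by
    decide +kernel
  exact List.mem_map.1 (check σ hσ b (mem_attachable two_pos hb hfree h))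

theorem sum_bond_full_lt_two (o : Bool) {b : PlacedTile ℕ} (hb : b.tile ∈ gadgetTiles)
    (hfree : ∀ u ∈ entryItem :: (full o).items, u.pos ≠ b.pos) :
    ((entryItem :: (full o).items).map fun u ↦ bond codeStrength u b).sum < 2 := by
  have check (o : Bool) :
      attachable codeStrength 2 gadgetTiles (entryItem :: (full o).items) = [] := by
    cases o <;> decide +kernel
  by_contra! h
  simpa [check o] using mem_attachable two_pos hb hfree h

theorem exists_items_full_eq (o : Bool) : ∃ σ ∈ growing, ∃ x : PlacedTile ℕ,
    (full o).items = σ.items ++ [x] ∧ x.pos = (11, 6) ∧ x.tile.east = if o then 71 else 72 := by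
  refine ⟨⟨38, 6, 6, o, (reportItems o).length - 1⟩, ?_,
    item 11 6 (if o then 25 else 70) (if o then 71 else 72) 0 0, ?_, rfl, rfl⟩ <;>
  cases o <;> decide +kernel

theorem items_sublist (σ : Progress) : σ.items.Sublist (full σ.winner).items := by
  simp only [items, full, frameItems, leftItems, rightItems, List.take_length]
  exact (((List.take_sublist _ _).append (List.take_sublist _ _)).append
    (List.take_sublist _ _)).append (List.take_sublist _ _)

theorem nodup_map_pos_items (σ : Progress) : (σ.items.map PlacedTile.pos).Nodup := by
  have check (o : Bool) : ((full o).items.map PlacedTile.pos).Nodup := by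
    cases o <;> decide +kernel
  exact (check _).sublist (σ.items_sublist.map _)

theorem items_subset (σ : Progress) : σ.items ⊆ gadgetItems.tail := by
  intro u hu
  simp only [items, List.mem_append] at hu
  have hmem : u ∈ frameItems ∨ u ∈ leftItems ∨ u ∈ rightItems ∨ u ∈ reportItems σ.winner := by
    rcases hu with ((hu | hu) | hu) | hu
    exacts [.inl (List.mem_of_mem_take hu), .inr (.inl (List.mem_of_mem_take hu)),
      .inr (.inr (.inl (List.mem_of_mem_take hu))), .inr (.inr (.inr (List.mem_of_mem_take hu)))]
  simp only [gadgetItems, List.tail_cons, List.mem_append]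
  cases hw : σ.winner <;> rw [hw] at hmem <;> tauto

end Progress

theorem pos_mem_Icc_of_mem_gadgetItems : ∀ u ∈ gadgetItems.tail, u.pos.1 ∈ Set.Icc 1 11 := by
  simp only [Set.mem_Icc]
  decide +kernel

theorem west_of_mem_gadgetItems : ∀ u ∈ gadgetItems,
    (u.tile.west = 26 → u.pos.1 = 1) ∧ (u.pos.1 = 1 → u.tile.west ≠ 0 → u.pos = (1, 6)) := by
  decide +kernel

theorem glue_of_mem_gadgetItems : ∀ u ∈ gadgetItems,
    u.tile.north < 71 ∧ u.tile.south < 71 ∧ u.tile.west < 71 ∧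
      (71 ≤ u.tile.east → u.pos.1 = 11) := by
  decide +kernel

theorem glue_lt_of_mem_gadgetTiles {t : Tile ℕ} (ht : t ∈ gadgetTiles) {d : Side}
    (hd : d ≠ .east) : t.glue d < 71 := by
  obtain ⟨u, hu, rfl⟩ := List.mem_map.1 ht
  obtain ⟨hn, hs, hw, -⟩ := glue_of_mem_gadgetItems u hu
  cases d
  exacts [hn, absurd rfl hd, hs, hw]

end Gadget

section Machine

/-- A glue consists of a code and, unless the code is below `18`, a state of the machine. -/
abbrev Glue (Q : Type) : Type :=
  ℕ × Option Q

/-- The strength of a glue depends on its code only. -/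
def glueStrength {Q : Type} (g : Glue Q) : ℕ :=
  codeStrength g.1

/-- The tile obtained by applying `f` to all glues. -/
def Tile.map {G H : Type} (f : G → H) (t : Tile G) : Tile H :=
  ⟨f t.north, f t.east, f t.south, f t.west, t.label⟩

theorem Tile.glue_map {G H : Type} (f : G → H) (t : Tile G) (d : Side) :
    (t.map f).glue d = f (t.glue d) := by
  cases d <;> rfl

/-- An automaton that reads random bits. The tile system builds one gadget per bit, and it stops
when the automaton leaves `states`. -/
structure Machine (Q : Type) where
  δ : Q → Bool → Q
  states : Finset Q
  start : Q
  start_mem : start ∈ states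

variable {Q : Type} (M : Machine Q) {q r : Q} {k c c' : ℕ} {u b : PlacedTile ℕ}

namespace Machine

/-- The state after the given bits, the head of the list being the last one. -/
def run : List Bool → Q
  | [] => M.start
  | o :: h => M.δ (run h) o

/-- The glue of a gadget in the state `q`. The codes `71` and `72` of the exits turn into the code
of the entry, with the next state. -/
def glue (q : Q) (c : ℕ) : Glue Q :=
  if c = 71 then (26, some (M.δ q true))
  else if c = 72 then (26, some (M.δ q false))
  else (c, if c < 18 then none else some q)

/-- The tile `u` of the `k`-th gadget, in the state `q`. -/
def place (q : Q) (k : ℕ) (u : PlacedTile ℕ) : PlacedTile (Glue Q) :=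
  ⟨u.tile.map (M.glue q), u.pos + (11 * (k : ℤ), 0)⟩

variable {M}

theorem glue_of_lt (hc : c < 71) : M.glue q c = (c, if c < 18 then none else some q) := by
  rw [glue, if_neg (by omega), if_neg (by omega)]

theorem glue_eq_glue_iff (hc : c < 71) (hc' : c = 26 → c' < 71) :
    M.glue q c = M.glue r c' ↔ c = c' ∧ (c < 18 ∨ q = r) := by
  rw [glue_of_lt hc]
  by_cases h : c' < 71
  · rw [glue_of_lt h, Prod.mk.injEq]
    refine and_congr_right fun hcc ↦ ?_
    subst hcc
    by_cases h18 : c < 18 <;> simp [h18]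
  · have hne : c ≠ 26 := mt hc' h
    have hne' : c ≠ c' := by omega
    simp only [glue]
    split_ifs <;> simp [hne, hne']

theorem glueStrength_glue (hc : c < 71) : glueStrength (M.glue q c) = codeStrength c := by
  rw [glue_of_lt hc, glueStrength]

theorem bond_place [DecidableEq Q] (hu : u ∈ gadgetItems) (hb : b.tile ∈ gadgetTiles)
    (hx : b.pos.1 ∈ Set.Icc 1 11) :
    bond glueStrength (M.place q k u) (M.place r k b) =
      if q = r then bond codeStrength u b else bond sharedStrength u b := by
  by_cases h : ∃ d : Side, b.pos = u.pos + d.offset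
  · obtain ⟨d, hd⟩ := h
    have hd' : (M.place r k b).pos = (M.place q k u).pos + d.offset := by
      simp only [place, hd, add_right_comm]
    have hx_add : b.pos.1 = u.pos.1 + d.offset.1 := congrArg Prod.fst hd
    obtain ⟨hn, hs, hw, he⟩ := glue_of_mem_gadgetItems u hu
    have hc : u.tile.glue d < 71 := by
      cases d
      exacts [hn, not_le.1 fun h ↦ by have := he h; simp [Side.offset] at hx_add; grind, hs, hw]
    have hc' : u.tile.glue d = 26 → b.tile.glue d.opposite < 71 := by
      intro h26
      refine glue_lt_of_mem_gadgetTiles hb ?_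
      rintro hopp
      obtain rfl : d = .west := by rw [← d.opposite_opposite, hopp]; rfl
      have := (west_of_mem_gadgetItems u hu).1 h26
      simp [Side.offset] at hx_add
      grind
    rw [bond_of_pos_eq hd', bond_of_pos_eq hd, bond_of_pos_eq hd]
    simp only [place, Tile.glue_map, glue_eq_glue_iff hc hc', glueStrength_glue hc, sharedStrength]
    by_cases hqr : q = r <;> grind
  · have h' (d : Side) : (M.place r k b).pos ≠ (M.place q k u).pos + d.offset := fun hd ↦
      h ⟨d, by simpa [place, add_right_comm _ _ d.offset] using hd⟩
    rw [bond_of_forall_pos_ne h', bond_of_forall_pos_ne (not_exists.1 h),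
      bond_of_forall_pos_ne (not_exists.1 h), ite_self]

end Machine

end Machine

section Inert

theorem bond_mono {G : Type} {str str' : G → ℕ} (h : ∀ g, str g ≤ str' g) (a b : PlacedTile G) :
    bond str a b ≤ bond str' a b := by
  unfold bond
  split_ifs <;> simp only [h, le_refl]

theorem bond_eq_zero_of_east {G : Type} {str : G → ℕ} {a b : PlacedTile G}
    (hx : a.pos.1 < b.pos.1) (h : b.pos = a.pos + (1, 0) → str a.tile.east = 0) :
    bond str a b = 0 := by
  by_contra hne
  obtain ⟨d, hd, -, hstr⟩ := exists_side_of_bond_ne_zero hne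
  cases d
  case east => exact hne (hstr.trans (h hd))
  all_goals simp [hd, Side.offset] at hx

theorem bond_congr_of_east_eq {G : Type} {str : G → ℕ} {a a' b : PlacedTile G}
    (hpos : a.pos = a'.pos) (heast : a.tile.east = a'.tile.east) (hx : a.pos.1 < b.pos.1) :
    bond str a b = bond str a' b := by
  classical
  by_cases h : b.pos = a.pos + Side.east.offset
  · rw [bond_of_pos_eq h, bond_of_pos_eq (hpos ▸ h),
      show a.tile.glue .east = a'.tile.glue .east from heast]
  · rw [bond_eq_zero_of_east hx fun h' ↦ absurd h' h,
      bond_eq_zero_of_east (hpos ▸ hx) fun h' ↦ absurd h' (hpos ▸ h)]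

theorem bond_eq_zero_of_west {G : Type} {str : G → ℕ} {a b : PlacedTile G}
    (hx : b.pos.1 < a.pos.1) (h : b.pos = a.pos + (-1, 0) → str a.tile.west = 0) :
    bond str a b = 0 := by
  by_contra hne
  obtain ⟨d, hd, -, hstr⟩ := exists_side_of_bond_ne_zero hne
  cases d
  case west => exact hne (hstr.trans (h hd))
  all_goals simp [hd, Side.offset] at hx

variable {Q : Type} {M : Machine Q} {q r : Q} {k : ℕ} {b : PlacedTile ℕ} {σ : Progress}

namespace Machine

theorem entryItem_items_subset (σ : Progress) : entryItem :: σ.items ⊆ gadgetItems :=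
  List.cons_subset_cons _ σ.items_subset

theorem sum_bond_place_le (hb : b.tile ∈ gadgetTiles) (hx : b.pos.1 ∈ Set.Icc 1 11) :
    ((entryItem :: σ.items).map fun u ↦
        bond glueStrength (M.place q k u) (M.place r k b)).sum ≤
      ((entryItem :: σ.items).map fun u ↦ bond codeStrength u b).sum := by
  classical
  refine List.sum_le_sum fun u hu ↦ ?_
  rw [bond_place (entryItem_items_subset σ hu) hb hx]
  split_ifs
  · exact le_rfl
  · refine bond_mono (fun c ↦ ?_) u b
    simp only [sharedStrength]
    split_ifs <;> simp

theorem two_le_sum_bond_place (hσ : σ ∈ Progress.growing) {e : PlacedTile ℕ × Progress}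
    (he : e ∈ σ.next) :
    2 ≤ ((entryItem :: σ.items).map fun u ↦
      bond glueStrength (M.place q k u) (M.place q k e.1)).sum := by
  classical
  have hmem := Progress.mem_gadgetItems_of_mem_next σ hσ e he
  rw [List.map_congr_left fun u hu ↦ (bond_place (entryItem_items_subset σ hu)
    (List.mem_map_of_mem (List.mem_of_mem_tail hmem))
    (pos_mem_Icc_of_mem_gadgetItems _ hmem)).trans (if_pos rfl)]
  exact Progress.two_le_sum_bond_of_mem_next hσ he

theorem place_eq_place_of_glue_lt {u : PlacedTile ℕ} (h : ∀ d, u.tile.glue d < 18) :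
    M.place q k u = M.place r k u := by
  have hglue (d : Side) : M.glue q (u.tile.glue d) = M.glue r (u.tile.glue d) := by
    have := h d
    simp only [glue_of_lt (by omega : u.tile.glue d < 71), if_pos (h d)]
  simp only [place, Tile.map, PlacedTile.mk.injEq, Tile.mk.injEq, and_true]
  exact ⟨hglue .north, hglue .east, hglue .south, hglue .west⟩

theorem exists_mem_next_of_two_le_sum_bond_place (hσ : σ ∈ Progress.growing)
    (hb : b.tile ∈ gadgetTiles) (hx : b.pos.1 ∈ Set.Icc 1 11)
    (hfree : ∀ u ∈ entryItem :: σ.items, u.pos ≠ b.pos)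
    (h : 2 ≤ ((entryItem :: σ.items).map fun u ↦
      bond glueStrength (M.place q k u) (M.place r k b)).sum) :
    ∃ e ∈ σ.next, M.place q k e.1 = M.place r k b := by
  classical
  obtain ⟨e, he, rfl⟩ :=
    Progress.exists_mem_next_of_two_le_sum_bond hσ hb hfree (h.trans (sum_bond_place_le hb hx))
  refine ⟨e, he, ?_⟩
  rcases eq_or_ne q r with rfl | hqr
  · rfl
  · refine place_eq_place_of_glue_lt (Progress.glue_lt_of_two_le_sum_sharedStrength hσ he ?_)
    rwa [List.map_congr_left fun u hu ↦ (bond_place (entryItem_items_subset σ hu) hb hx).trans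
      (if_neg hqr)] at h

/-- The entry of the first gadget, and all tiles of the gadgets for the given bits. -/
def tilesBefore (M : Machine Q) : List Bool → List (PlacedTile (Glue Q))
  | [] => [M.place M.start 0 entryItem]
  | o :: h => tilesBefore M h ++ (Progress.full o).items.map (M.place (M.run h) h.length)

theorem pos_le_of_mem_tilesBefore {h : List Bool} {a : PlacedTile (Glue Q)}
    (ha : a ∈ M.tilesBefore h) : a.pos.1 ≤ 11 * h.length := by
  induction h with
  | nil => simp_all [tilesBefore, place, entryItem, item]
  | cons o h ih =>
    rcases List.mem_append.1 ha with ha | ha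
    · have := ih ha
      grind
    · obtain ⟨u, hu, rfl⟩ := List.mem_map.1 ha
      have := (pos_mem_Icc_of_mem_gadgetItems u (Progress.items_subset _ hu)).2
      simp only [place, Prod.fst_add, List.length_cons]
      grind

theorem exists_mem_tilesBefore_pos_eq (h : List Bool) :
    ∃ a ∈ M.tilesBefore h, a.pos = (11 * (h.length : ℤ), 6) := by
  cases h with
  | nil => exact ⟨_, List.mem_singleton_self _, by simp [place, entryItem, item]⟩
  | cons o h =>
    obtain ⟨_, -, x, hitems, hpos, -⟩ := Progress.exists_items_full_eq o
    refine ⟨_, List.mem_append_right _ (List.mem_map_of_mem (a := x) (by simp [hitems])), ?_⟩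
    simp [place, hpos]
    ring

/-- The only way for a gadget to bond to the west is through the place of its entry. -/
theorem sum_bond_place_eq_zero_of_le {h : List Bool} {b : PlacedTile (Glue Q)}
    (hfree : ∀ a ∈ M.tilesBefore h, a.pos ≠ b.pos) (hx : b.pos.1 ≤ 11 * h.length) :
    (σ.items.map fun u ↦ bond glueStrength (M.place q h.length u) b).sum = 0 := by
  refine List.sum_eq_zero fun n hn ↦ ?_
  obtain ⟨u, hu, rfl⟩ := List.mem_map.1 hn
  have hmem := σ.items_subset hu
  have hux := (pos_mem_Icc_of_mem_gadgetItems u hmem).1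
  have hpos : (M.place q h.length u).pos.1 = u.pos.1 + 11 * h.length := rfl
  refine bond_eq_zero_of_west (by omega) fun hwest ↦ ?_
  have hu1 : u.pos.1 = 1 := by
    have : b.pos.1 = u.pos.1 + 11 * h.length + -1 := congrArg Prod.fst hwest
    omega
  by_contra hne
  have hw0 : u.tile.west ≠ 0 := by
    rintro h0
    refine hne ?_
    rw [place, Tile.map, glueStrength_glue (by omega), h0]
    rfl
  have hu16 := (west_of_mem_gadgetItems u (List.mem_of_mem_tail hmem)).2 hu1 hw0
  obtain ⟨a, ha, hapos⟩ := M.exists_mem_tilesBefore_pos_eq h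
  refine hfree a ha (hapos.trans ?_)
  rw [hwest, place, hu16]
  ext <;> simp

theorem sum_bond_place_eq_zero_of_lt (hσ : σ ∈ Progress.growing) {b : PlacedTile (Glue Q)}
    (hx : 11 * k + 11 < b.pos.1) :
    ((entryItem :: σ.items).map fun u ↦ bond glueStrength (M.place q k u) b).sum = 0 := by
  refine List.sum_eq_zero fun n hn ↦ ?_
  obtain ⟨u, hu, rfl⟩ := List.mem_map.1 hn
  have hpos : (M.place q k u).pos.1 = u.pos.1 + 11 * k := rfl
  have hu11 : u.pos.1 ≤ 11 := by
    rcases List.mem_cons.1 hu with rfl | hu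
    · simp [entryItem, item]
    · exact (pos_mem_Icc_of_mem_gadgetItems u (σ.items_subset hu)).2
  refine bond_eq_zero_of_east (by omega) fun heast ↦ ?_
  have hu11' : u.pos.1 = 11 := by
    have : b.pos.1 = u.pos.1 + 11 * k + 1 := congrArg Prod.fst heast
    omega
  have h0 : u.tile.east = 0 := by
    rcases List.mem_cons.1 hu with rfl | hu
    · simp [entryItem, item] at hu11'
    · exact Progress.east_eq_zero_of_mem_growing σ hσ u hu hu11'
  rw [place, Tile.map, glueStrength_glue (by omega), h0]
  rfl

end Machine

end Inert

section System

variable {Q : Type} (M : Machine Q)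

namespace Machine

/-- The bits drawn by the complete gadgets, and the progress of the current gadget. -/
abbrev State : Type :=
  List Bool × Progress

/-- The tiles of the complete gadgets and of the current one. -/
def tiles (s : State) : List (PlacedTile (Glue Q)) :=
  M.tilesBefore s.1 ++ s.2.items.map (M.place (M.run s.1) s.1.length)

variable {M} {q : Q} {b : PlacedTile (Glue Q)} {h : List Bool} {σ : Progress}

theorem nodup_map_pos_tiles (h : List Bool) (σ : Progress) :
    ((M.tiles (h, σ)).map PlacedTile.pos).Nodup := by
  have hbefore : ((M.tilesBefore h).map PlacedTile.pos).Nodup := by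
    cases h with
    | nil => exact List.nodup_singleton _
    | cons o h => exact nodup_map_pos_tiles h (Progress.full o)
  rw [tiles, List.map_append]
  refine List.Nodup.append hbefore ?_ ?_
  · rw [List.map_map, show PlacedTile.pos ∘ M.place (M.run h) h.length =
      (fun z ↦ z + (11 * (h.length : ℤ), 0)) ∘ PlacedTile.pos from rfl, ← List.map_map]
    exact σ.nodup_map_pos_items.map (add_left_injective _)
  · intro z hz hz'
    obtain ⟨a, ha, rfl⟩ := List.mem_map.1 hz
    obtain ⟨b, hb, hab⟩ := List.mem_map.1 hz'
    obtain ⟨u, hu, rfl⟩ := List.mem_map.1 hb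
    have hle : a.pos.1 ≤ 11 * h.length := pos_le_of_mem_tilesBefore ha
    have hge := (pos_mem_Icc_of_mem_gadgetItems u (σ.items_subset hu)).1
    have : u.pos.1 + 11 * h.length = a.pos.1 := congrArg Prod.fst hab
    omega

/-- To the east, only the glue at the entry of the current gadget is exposed. -/
theorem sum_bond_tilesBefore_of_lt (hx : 11 * h.length < b.pos.1) :
    ((M.tilesBefore h).map fun a ↦ bond glueStrength a b).sum =
      bond glueStrength (M.place (M.run h) h.length entryItem) b := by
  induction h with
  | nil => simp [tilesBefore, run]
  | cons o h ih =>
    obtain ⟨σ, hσ, x, hitems, hpos, heast⟩ := Progress.exists_items_full_eq o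
    have hx' : 11 * (h.length : ℤ) + 11 < b.pos.1 := by
      simp only [List.length_cons] at hx
      grind
    have hzero := sum_bond_place_eq_zero_of_lt (q := M.run h) (M := M) hσ hx'
    rw [List.map_cons, List.sum_cons, ← ih (by omega)] at hzero
    have hexit : bond glueStrength (M.place (M.run h) h.length x) b =
        bond glueStrength (M.place (M.run (o :: h)) (o :: h).length entryItem) b := by
      refine bond_congr_of_east_eq ?_ ?_ ?_
      · ext <;> simp [place, hpos, entryItem, item]
        ring
      · simp only [place, Tile.map, heast]
        cases o <;> rfl
      · simp only [place, hpos, Prod.fst_add]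
        omega
    rw [tilesBefore, hitems, List.map_append, List.map_append, List.map_append, List.sum_append,
      List.sum_append, ← add_assoc, List.map_map, Function.comp_def, hzero, zero_add, ← hexit]
    simp

theorem sum_bond_tiles_of_le (hfree : ∀ a ∈ M.tilesBefore h, a.pos ≠ b.pos)
    (hx : b.pos.1 ≤ 11 * h.length) :
    ((M.tiles (h, σ)).map fun a ↦ bond glueStrength a b).sum =
      ((M.tilesBefore h).map fun a ↦ bond glueStrength a b).sum := by
  rw [tiles, List.map_append, List.sum_append, List.map_map, Function.comp_def,
    sum_bond_place_eq_zero_of_le hfree hx, add_zero]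

theorem sum_bond_tiles_of_lt (hx : 11 * h.length < b.pos.1) :
    ((M.tiles (h, σ)).map fun a ↦ bond glueStrength a b).sum =
      ((entryItem :: σ.items).map fun u ↦
        bond glueStrength (M.place (M.run h) h.length u) b).sum := by
  rw [tiles, List.map_append, List.sum_append, sum_bond_tilesBefore_of_lt hx, List.map_cons,
    List.sum_cons, List.map_map, Function.comp_def]

theorem place_pos_mem_Ioc_iff {k : ℕ} {u : PlacedTile ℕ} :
    (M.place q k u).pos.1 ∈ Set.Ioc (11 * k : ℤ) (11 * k + 11) ↔ u.pos.1 ∈ Set.Icc 1 11 := by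
  simp only [place, Prod.fst_add, Set.mem_Ioc, Set.mem_Icc]
  omega

theorem forall_pos_ne_of_tiles {u : PlacedTile ℕ} (hx : u.pos.1 ∈ Set.Icc 1 11)
    (hfree : ∀ a ∈ M.tiles (h, σ), a.pos ≠ (M.place q h.length u).pos) :
    ∀ v ∈ entryItem :: σ.items, v.pos ≠ u.pos := by
  rintro v hv hvu
  rcases List.mem_cons.1 hv with rfl | hv
  · simp [← hvu, entryItem, item] at hx
  · refine hfree _ (List.mem_append_right _ (List.mem_map_of_mem hv)) ?_
    simp only [place, hvu]

variable [DecidableEq Q]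

variable (M) in
/-- The assembly that consists of the tiles of a state. -/
def assembly (s : State) : Assembly (Glue Q) where
  tiles := (M.tiles s).toFinset
  pos_unique _ ha _ hb hab := List.inj_on_of_nodup_map (nodup_map_pos_tiles s.1 s.2)
    (List.mem_toFinset.1 ha) (List.mem_toFinset.1 hb) hab

variable (M) in
/-- The tile types of the gadgets in the states of the machine. -/
def tileSet : Finset (Tile (Glue Q)) :=
  (gadgetTiles.toFinset ×ˢ M.states).image fun e ↦ e.1.map (M.glue e.2)

variable (M) in
/-- The tile system whose gadgets feed random bits to the machine. -/
def system : TileSystem (Glue Q) where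
  strength := glueStrength
  tileSet := M.tileSet
  seed := M.assembly ([], Progress.zero)
  seed_mem a ha := by
    obtain rfl := List.mem_singleton.1 (List.mem_toFinset.1 ha)
    exact Finset.mem_image.2 ⟨(entryItem.tile, M.start), Finset.mem_product.2
      ⟨List.mem_toFinset.2 (List.mem_map_of_mem List.mem_cons_self), M.start_mem⟩, rfl⟩
  temperature := 2
  temperature_pos := two_pos

variable (M) in
theorem card_tileSet_le : M.tileSet.card ≤ 75 * M.states.card := by
  have hlength : gadgetTiles.length = 75 := by
    decide +kernel
  calc M.tileSet.card
      ≤ gadgetTiles.toFinset.card * M.states.card :=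
        Finset.card_image_le.trans (Finset.card_product _ _).le
    _ ≤ 75 * M.states.card :=
        Nat.mul_le_mul_right _ (hlength ▸ List.toFinset_card_le gadgetTiles)

theorem mem_tileSet_iff {t : Tile (Glue Q)} :
    t ∈ M.tileSet ↔ ∃ t' ∈ gadgetTiles, ∃ r ∈ M.states, t'.map (M.glue r) = t := by
  simp only [tileSet, Finset.mem_image, Finset.mem_product, List.mem_toFinset, Prod.exists,
    and_assoc, exists_and_left]

theorem exists_place_eq (hb : b.tile ∈ M.tileSet) (k : ℕ) :
    ∃ r b', b'.tile ∈ gadgetTiles ∧ M.place r k b' = b := by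
  obtain ⟨t, ht, r, -, hbt⟩ := mem_tileSet_iff.1 hb
  exact ⟨r, ⟨t, b.pos - (11 * (k : ℤ), 0)⟩, ht, by simp [place, hbt]⟩

theorem mem_states_of_map_mem_tileSet {t : Tile ℕ} (ht : t.map (M.glue q) ∈ M.tileSet)
    (hw : t.west ∈ Set.Ico 18 71) : q ∈ M.states := by
  obtain ⟨t', ht', r, hr, htt⟩ := mem_tileSet_iff.1 ht
  have hwest : M.glue r t'.west = M.glue q t.west := congrArg Tile.west htt
  have hlt : t'.west < 71 := glue_lt_of_mem_gadgetTiles ht' (d := .west) (by decide)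
  obtain ⟨heq, hor⟩ := (glue_eq_glue_iff hlt fun _ ↦ hw.2).1 hwest
  have hrq : r = q := hor.resolve_left (not_lt.2 (heq ▸ hw.1))
  exact hrq ▸ hr

theorem sum_assembly (s : State) (b : PlacedTile (Glue Q)) :
    ∑ a ∈ (M.assembly s).tiles, bond glueStrength a b =
      ((M.tiles s).map fun a ↦ bond glueStrength a b).sum :=
  List.sum_toFinset _ (nodup_map_pos_tiles s.1 s.2).of_map

theorem sum_bond_tilesBefore_lt_two (hb : b.tile ∈ M.tileSet)
    (hfree : ∀ a ∈ M.tilesBefore h, a.pos ≠ b.pos) (hx : b.pos.1 ≤ 11 * h.length) :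
    ((M.tilesBefore h).map fun a ↦ bond glueStrength a b).sum < 2 := by
  induction h with
  | nil =>
    have hzero : bond glueStrength (M.place M.start 0 entryItem) b = 0 := by
      by_contra hne
      obtain ⟨d, hd, -, hstr⟩ := exists_side_of_bond_ne_zero hne
      cases d
      case east => simp [hd, place, entryItem, item, Side.offset] at hx
      all_goals exact hne (hstr.trans rfl)
    simp [tilesBefore, hzero]
  | cons o h ih =>
    change ((M.tiles (h, Progress.full o)).map fun a ↦ bond glueStrength a b).sum < 2
    have hfree' : ∀ a ∈ M.tilesBefore h, a.pos ≠ b.pos := fun a ha ↦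
      hfree a (List.mem_append_left _ ha)
    rcases le_or_gt b.pos.1 (11 * h.length) with hle | hlt
    · rw [sum_bond_tiles_of_le hfree' hle]
      exact ih hfree' hle
    · rw [sum_bond_tiles_of_lt hlt]
      obtain ⟨r, b, hbt, rfl⟩ := exists_place_eq hb h.length
      have hxb : b.pos.1 ∈ Set.Icc 1 11 := place_pos_mem_Ioc_iff.1
        ⟨hlt, by simpa [mul_add] using hx⟩
      exact (sum_bond_place_le hbt hxb).trans_lt
        (Progress.sum_bond_full_lt_two o hbt (forall_pos_ne_of_tiles hxb hfree))

theorem exists_mem_next_of_two_le_sum_bond_tiles (hσ : σ ∈ Progress.growing)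
    (hb : b.tile ∈ M.tileSet) (hfree : ∀ a ∈ M.tiles (h, σ), a.pos ≠ b.pos)
    (hsum : 2 ≤ ((M.tiles (h, σ)).map fun a ↦ bond glueStrength a b).sum) :
    ∃ e ∈ σ.next, M.place (M.run h) h.length e.1 = b := by
  rcases le_or_gt b.pos.1 (11 * h.length) with hle | hlt
  · have hfree' : ∀ a ∈ M.tilesBefore h, a.pos ≠ b.pos := fun a ha ↦
      hfree a (List.mem_append_left _ ha)
    rw [sum_bond_tiles_of_le hfree' hle] at hsum
    exact absurd hsum (sum_bond_tilesBefore_lt_two hb hfree' hle).not_ge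
  · rw [sum_bond_tiles_of_lt hlt] at hsum
    rcases le_or_gt b.pos.1 (11 * h.length + 11) with hle | hlt'
    · obtain ⟨r, b, hbt, rfl⟩ := exists_place_eq hb h.length
      have hxb : b.pos.1 ∈ Set.Icc 1 11 := place_pos_mem_Ioc_iff.1 ⟨hlt, hle⟩
      exact exists_mem_next_of_two_le_sum_bond_place hσ hbt hxb
        (forall_pos_ne_of_tiles hxb hfree) hsum
    · rw [sum_bond_place_eq_zero_of_lt hσ hlt'] at hsum
      omega

end Machine

end System

section Represents

variable {Q : Type} [DecidableEq Q] (M : Machine Q)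

theorem TileSystem.Attaches.pos_ne {G : Type} {Γ : TileSystem G} {A B : Assembly G}
    {b : PlacedTile G} (h : Γ.Attaches A b B) : ∀ a ∈ A.tiles, a.pos ≠ b.pos := by
  obtain ⟨-, hnot, hins, -⟩ := h
  intro a ha hab
  refine hnot (B.pos_unique a ?_ b ?_ hab ▸ ha) <;> simp [hins, ha]

namespace Machine

/-- The state reached by the progress `σ` of the current gadget. As soon as the gadget is complete,
its bit is passed to the machine. -/
def advance (h : List Bool) (σ : Progress) : State :=
  if σ = .full σ.winner then (σ.winner :: h, .zero) else (h, σ)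

/-- The possible attachments in a state. There are none once the machine has left `states`, because
the frame of the next gadget cannot begin. -/
def next (s : State) : List (PlacedTile (Glue Q) × State) :=
  if M.run s.1 ∈ M.states then
    s.2.next.map fun e ↦ (M.place (M.run s.1) s.1.length e.1, advance s.1 e.2)
  else []

/-- The invariant of the reachable states. -/
structure Valid (s : State) : Prop where
  growing : s.2 ∈ Progress.growing
  stable : (M.assembly s).Stable glueStrength 2
  halted : M.run s.1 ∉ M.states → s.2 = .zero

variable {M} {s : State} {e : PlacedTile (Glue Q) × State}

omit [DecidableEq Q] in
theorem tiles_advance (h : List Bool) (σ : Progress) :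
    M.tiles (advance h σ) = M.tiles (h, σ) := by
  unfold advance
  split_ifs with hfull
  · rw [tiles, tiles, tilesBefore, ← hfull]
    simp [Progress.items, Progress.zero]
  · rfl

theorem mem_next_iff : e ∈ M.next s ↔ M.run s.1 ∈ M.states ∧
    ∃ e' ∈ s.2.next, (M.place (M.run s.1) s.1.length e'.1, advance s.1 e'.2) = e := by
  rw [next]
  split_ifs with h <;> simp only [h, List.mem_map, true_and, false_and, List.not_mem_nil]

theorem valid_start : M.Valid ([], .zero) where
  growing := Progress.zero_mem_growing
  stable S hS hne hne' := by
    have htiles : (M.assembly ([], .zero)).tiles = {M.place M.start 0 entryItem} := rfl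
    rw [htiles] at hS hne'
    exact absurd (Finset.Nonempty.subset_singleton_iff hne |>.1 hS) hne'
  halted _ := rfl

theorem Valid.attaches (hs : M.Valid s) (he : e ∈ M.next s) :
    M.system.Attaches (M.assembly s) e.1 (M.assembly e.2) := by
  classical
  obtain ⟨h, σ⟩ := s
  obtain ⟨hrun, e, heσ, rfl⟩ := mem_next_iff.1 he
  simp only at hrun heσ ⊢
  have hmem := Progress.mem_gadgetItems_of_mem_next σ hs.growing e heσ
  have hx := pos_mem_Icc_of_mem_gadgetItems e.1 hmem
  have hlt : 11 * h.length < (M.place (M.run h) h.length e.1).pos.1 :=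
    (place_pos_mem_Ioc_iff.2 hx).1
  have hfree : M.place (M.run h) h.length e.1 ∉ M.tiles (h, σ) := by
    intro hmem
    rcases List.mem_append.1 hmem with hmem | hmem
    · exact (pos_le_of_mem_tilesBefore hmem).not_gt hlt
    · obtain ⟨u, hu, hue⟩ := List.mem_map.1 hmem
      refine Progress.free_of_mem_next σ hs.growing e heσ u (List.mem_cons_of_mem _ hu) ?_
      simpa [place] using congrArg PlacedTile.pos hue
  have hperm : (M.tiles (advance h e.2)).Perm
      (M.place (M.run h) h.length e.1 :: M.tiles (h, σ)) := by
    rw [tiles_advance]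
    exact (((Progress.items_perm_of_mem_next σ hs.growing e heσ).map _).append_left _).trans
      List.perm_middle
  have hins : (M.assembly (advance h e.2)).tiles =
      insert (M.place (M.run h) h.length e.1) (M.assembly (h, σ)).tiles := by
    ext a
    simp only [assembly, List.mem_toFinset, Finset.mem_insert, hperm.mem_iff, List.mem_cons]
  refine ⟨mem_tileSet_iff.2 ⟨_, List.mem_map_of_mem (List.mem_of_mem_tail hmem), _, hrun, rfl⟩,
    mt List.mem_toFinset.1 hfree, by convert hins, hs.stable.of_le_sum_bond (by convert hins) ?_⟩
  rw [sum_assembly, sum_bond_tiles_of_lt hlt]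
  exact two_le_sum_bond_place hs.growing heσ

theorem Valid.next (hs : M.Valid s) (he : e ∈ M.next s) : M.Valid e.2 where
  growing := by
    obtain ⟨-, e, heσ, rfl⟩ := mem_next_iff.1 he
    unfold advance
    split_ifs with hfull
    · exact Progress.zero_mem_growing
    · exact (Progress.mem_growing_or_eq_full _ hs.growing e heσ).resolve_right hfull
  stable := (hs.attaches he).2.2.2
  halted := by
    obtain ⟨hrun, e, -, rfl⟩ := mem_next_iff.1 he
    unfold advance
    split_ifs with hfull
    exacts [fun _ ↦ rfl, fun hnot ↦ absurd hrun hnot]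

theorem valid_of_reach (hs : Reach M.next ([], .zero) s) : M.Valid s := by
  induction hs with
  | refl => exact valid_start
  | tail _ h ih =>
    obtain ⟨b, hb⟩ := h
    exact ih.next hb

theorem Valid.frontier (hs : M.Valid s) {b : PlacedTile (Glue Q)}
    (hb : b ∈ M.system.frontier (M.assembly s)) : ∃ t, (b, t) ∈ M.next s := by
  classical
  obtain ⟨h, σ⟩ := s
  obtain ⟨B, hB⟩ := hb
  have hsum := hB.2.2.2.le_sum_bond hB.2.1 hB.2.2.1 ?_
  · obtain ⟨e, heσ, rfl⟩ := exists_mem_next_of_two_le_sum_bond_tiles hs.growing hB.1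
      (fun a ha ↦ hB.pos_ne a (List.mem_toFinset.2 ha)) (by rwa [← sum_assembly])
    refine ⟨_, mem_next_iff.2 ⟨?_, e, heσ, rfl⟩⟩
    by_contra hnot
    obtain rfl : σ = .zero := hs.halted hnot
    obtain rfl := List.mem_singleton.1 heσ
    exact hnot (mem_states_of_map_mem_tileSet hB.1
      (show 26 ∈ Set.Ico 18 71 from ⟨by norm_num, by norm_num⟩))
  · obtain ⟨a, ha, -⟩ := exists_mem_tilesBefore_pos_eq (M := M) h
    exact ⟨a, List.mem_toFinset.2 (List.mem_append_left _ ha)⟩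

theorem Valid.nodup (hs : M.Valid s) : ((M.next s).map Prod.fst).Nodup := by
  rw [Machine.next]
  split_ifs
  · refine List.Nodup.of_map (fun b ↦ (b.pos - (11 * (s.1.length : ℤ), 0), b.tile.north.1)) ?_
    rw [List.map_map, List.map_map]
    convert Progress.nodup_map_next s.2 hs.growing using 1
    refine List.map_congr_left fun e he ↦ ?_
    have hnorth := (glue_of_mem_gadgetItems e.1 (List.mem_of_mem_tail
      (Progress.mem_gadgetItems_of_mem_next s.2 hs.growing e he))).1
    simp [place, Tile.map, glue_of_lt hnorth]
  · exact List.nodup_nil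

variable (M) in
theorem represents : Represents M.system M.assembly M.next ([], .zero) where
  seed := rfl
  attaches hs _ he := (valid_of_reach hs).attaches he
  frontier hs _ hb := (valid_of_reach hs).frontier hb
  nodup hs := (valid_of_reach hs).nodup

variable (M) in
theorem extensible : M.system.Extensible 2 := by
  refine M.represents.extensible fun s hs ↦ ?_
  rw [next]
  split_ifs
  · simpa using Progress.length_next_le_two s.2 (valid_of_reach hs).growing
  · exact Nat.zero_le 2

end Machine

end Represents

section Race

/-- The mean of `A` and `B` with weights proportional to `c` and `d`. -/
noncomputable def mix (c d : ℝ≥0) (A B : ℝ≥0∞) : ℝ≥0∞ :=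
  c / (c + d) * A + d / (c + d) * B

variable {c d ρ : ℝ≥0} {A A' B B' : ℝ≥0∞} {l r : List ℝ≥0}

theorem mix_mono (hA : A ≤ A') (hB : B ≤ B') : mix c d A B ≤ mix c d A' B' := by
  unfold mix
  gcongr

theorem mix_comm (c d : ℝ≥0) (A B : ℝ≥0∞) : mix c d A B = mix d c B A := by
  rw [mix, mix, add_comm (c : ℝ≥0∞), add_comm (_ * A)]

theorem mix_self (hc : c ≠ 0) (d : ℝ≥0) (A : ℝ≥0∞) : mix c d A A = A := by
  have hne : (c : ℝ≥0∞) + d ≠ 0 := by simp [hc]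
  rw [mix, ← add_mul, ← ENNReal.add_div, ENNReal.div_self hne (by finiteness), one_mul]

theorem mix_const_add (hc : c ≠ 0) (d : ℝ≥0) (K A B : ℝ≥0∞) :
    mix c d (K + A) (K + B) = K + mix c d A B := by
  conv_rhs => rw [← mix_self hc d K]
  unfold mix
  ring

theorem half_mul_le_mix (hc : c ≠ 0) (hd : d ≤ c) (A B : ℝ≥0∞) : 2⁻¹ * A ≤ mix c d A B := by
  have hweight : (2⁻¹ : ℝ≥0∞) ≤ c / (c + d) := by
    rw [ENNReal.le_div_iff_mul_le (.inl (by simp [hc])) (.inl (by finiteness)), mul_comm,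
      ← div_eq_mul_inv]
    refine ENNReal.div_le_of_le_mul ?_
    rw [mul_two]
    gcongr
  exact (mul_le_mul_left hweight A).trans le_self_add

/-- The expected payoff of a race in which the steps of the two contestants have the given rates:
`x` if the first one arrives first, and `y` otherwise. -/
noncomputable def raceVal (x y : ℝ≥0∞) : List ℝ≥0 → List ℝ≥0 → ℝ≥0∞
  | [], _ => x
  | _ :: _, [] => y
  | c :: l, d :: r => mix c d (raceVal x y l (d :: r)) (raceVal x y (c :: l) r)

theorem raceVal_swap (x y : ℝ≥0∞) (hl : l ≠ []) : raceVal x y l r = raceVal y x r l := by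
  induction l generalizing r with
  | nil => contradiction
  | cons c l ihl =>
    induction r with
    | nil => simp only [raceVal]
    | cons d r ihr =>
      rw [raceVal, raceVal, ihr, mix_comm]
      congr 1
      cases l with
      | nil => simp only [raceVal]
      | cons => exact ihl (List.cons_ne_nil _ _)

theorem raceVal_eq_add (x y : ℝ≥0∞) (l r : List ℝ≥0) :
    raceVal x y l r = raceVal 1 0 l r * x + raceVal 0 1 l r * y := by
  induction l generalizing r with
  | nil => simp [raceVal]
  | cons c l ihl =>
    induction r with
    | nil => simp [raceVal]
    | cons d r ihr =>
      simp only [raceVal]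
      rw [ihl, ihr]
      unfold mix
      ring

theorem raceVal_self (hl : ∀ c ∈ l, c ≠ 0) (x : ℝ≥0∞) (r : List ℝ≥0) : raceVal x x l r = x := by
  induction l generalizing r with
  | nil => rw [raceVal]
  | cons c l ihl =>
    induction r with
    | nil => rw [raceVal]
    | cons d r ihr =>
      rw [raceVal, ihr, ihl fun c hc ↦ hl c (List.mem_cons_of_mem _ hc),
        mix_self (hl c List.mem_cons_self)]

theorem raceVal_le_add (hl : ∀ c ∈ l, c ≠ 0) (x y : ℝ≥0∞) (r : List ℝ≥0) :
    raceVal x y l r ≤ x + y := by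
  calc raceVal x y l r = raceVal 1 0 l r * x + raceVal 0 1 l r * y := raceVal_eq_add x y l r
    _ ≤ raceVal 1 0 l r * (x + y) + raceVal 0 1 l r * (x + y) := by
      gcongr
      exacts [le_self_add, le_add_self]
    _ = x + y := (raceVal_eq_add _ _ l r).symm.trans (raceVal_self hl _ r)

/-- With probability at least `1 / 2`, the faster contestant takes the next step, and the first one
does so when the second one faces its slowest step. -/
theorem inv_two_pow_le_raceVal (r₁ r₂ : List ℝ≥0) (hl : ∀ c ∈ l, c ≠ 0) (hρ : ∀ c ∈ l, ρ ≤ c) :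
    2⁻¹ ^ (l.length + r₁.length) ≤ raceVal 1 0 l (r₁ ++ ρ :: r₂) := by
  induction l generalizing r₁ with
  | nil =>
    rw [raceVal]
    exact pow_le_one' (ENNReal.inv_le_one.2 one_le_two) _
  | cons c l ihl =>
    have ihl' (s : List ℝ≥0) := ihl s (fun c hc ↦ hl c (List.mem_cons_of_mem _ hc))
      fun c hc ↦ hρ c (List.mem_cons_of_mem _ hc)
    have hc := hl c List.mem_cons_self
    induction r₁ with
    | nil =>
      rw [List.nil_append, raceVal]
      refine le_trans ?_ (half_mul_le_mix hc (hρ c List.mem_cons_self) _ _)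
      rw [List.length_cons, add_right_comm, pow_succ']
      gcongr
      exact ihl' []
    | cons d r₁ ihr =>
      rw [List.cons_append, raceVal]
      rcases le_total d c with h | h
      · refine le_trans ?_ (half_mul_le_mix hc h _ _)
        rw [List.length_cons, add_right_comm, pow_succ']
        gcongr
        exact ihl' (d :: r₁)
      · rw [mix_comm]
        refine le_trans ?_ (half_mul_le_mix ((pos_of_ne_zero hc).trans_le h).ne' h _ _)
        rw [List.length_cons, List.length_cons, ← add_assoc, pow_succ']
        gcongr
        exact ihr

theorem inv_two_pow_le_raceVal_of_perm (hlr : l.Perm r) (hl : ∀ c ∈ l, c ≠ 0) (hc : c ∈ l) :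
    2⁻¹ ^ (2 * l.length) ≤ raceVal 1 0 (l ++ [c]) (r ++ [d]) := by
  obtain ⟨ρ, hρ, hmin⟩ := l.toFinset.exists_min_image id ⟨c, List.mem_toFinset.2 hc⟩
  simp only [List.mem_toFinset, id_eq] at hρ hmin
  obtain ⟨r₁, r₂, rfl⟩ := List.append_of_mem (hlr.subset hρ)
  have hmem {x : ℝ≥0} (hx : x ∈ l ++ [c]) : x ∈ l := by
    rcases List.mem_append.1 hx with hx | hx
    exacts [hx, List.mem_singleton.1 hx ▸ hc]
  have hlength := hlr.length_eq
  simp only [List.length_append, List.length_cons] at hlength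
  rw [List.append_assoc, List.cons_append]
  refine (pow_le_pow_right_of_le_one' (by simp) ?_).trans
    (inv_two_pow_le_raceVal r₁ _ (fun x hx ↦ hl x (hmem hx)) fun x hx ↦ hmin x (hmem hx))
  simp only [List.length_append, List.length_cons, List.length_nil]
  omega

/-- The slowest rate occurs before the last step of either contestant, and so both of them have a
fair chance, no matter how different the rates are. -/
theorem exists_race_weights (hlr : l.Perm r) (hl : ∀ c ∈ l, c ≠ 0) (hc : c ∈ l) (hd : d ∈ l) :
    ∃ α β : ℝ≥0∞, α + β = 1 ∧ 2⁻¹ ^ (2 * l.length) ≤ α ∧ 2⁻¹ ^ (2 * l.length) ≤ β ∧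
      ∀ x y, raceVal x y (l ++ [c]) (r ++ [d]) = α * x + β * y := by
  refine ⟨_, _, ?_, inv_two_pow_le_raceVal_of_perm hlr hl hc, ?_, fun x y ↦ raceVal_eq_add x y _ _⟩
  · have hl' : ∀ x ∈ l ++ [c], x ≠ 0 := by
      simpa [or_imp, forall_and] using ⟨hl, hl c hc⟩
    simpa using (raceVal_eq_add 1 1 (l ++ [c]) (r ++ [d])).symm.trans (raceVal_self hl' 1 _)
  · rw [raceVal_swap 0 1 (by simp), hlr.length_eq]
    exact inv_two_pow_le_raceVal_of_perm hlr.symm (fun c hc ↦ hl c (hlr.mem_iff.2 hc))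
      (hlr.mem_iff.1 hd)

end Race

section Potential

/-- All steps of the left contestant in the race of a gadget: its arm and its claim. -/
def leftPath : List (PlacedTile ℕ) :=
  leftItems ++ (reportItems true).take 1

/-- All steps of the right contestant in the race of a gadget: its arm and its claim. -/
def rightPath : List (PlacedTile ℕ) :=
  rightItems ++ (reportItems false).take 1

theorem glue_lt_of_mem_path {u : PlacedTile ℕ} (hu : u ∈ leftPath ++ rightPath) (d : Side) :
    u.tile.glue d < 18 := by
  have check : ∀ u ∈ leftPath ++ rightPath,
      ∀ d ∈ [Side.north, .east, .south, .west], u.tile.glue d < 18 := by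
    decide +kernel
  exact check u hu d (by cases d <;> simp)

namespace Progress

variable {σ : Progress}

/-- The number of tiles that are present, except for the entry. -/
def count (σ : Progress) : ℕ :=
  σ.frame + σ.left + σ.right + σ.report

theorem count_of_mem_next : ∀ σ ∈ growing, ∀ e ∈ σ.next,
    e.2.count = σ.count + 1 ∧ e.2.count ≤ 63 := by
  decide +kernel

theorem report_ne_zero_of_mem_next (hσ : σ.report ≠ 0) {e : PlacedTile ℕ × Progress}
    (he : e ∈ σ.next) : e.2.report ≠ 0 ∧ e.2.winner = σ.winner := by
  unfold next leftNext rightNext reportNext at he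
  grind

theorem next_of_report_eq_zero : ∀ σ ∈ growing, σ.report = 0 → σ.next = [σ.leftNext, σ.rightNext] ∨
    ∀ e ∈ σ.next, e.2.report = 0 ∧ e.2.left = σ.left ∧ e.2.right = σ.right := by
  decide +kernel

theorem drop_path_of_mem_growing : ∀ σ ∈ growing,
    leftPath.drop σ.left = σ.leftNext.1 :: leftPath.drop (σ.left + 1) ∧
      rightPath.drop σ.right = σ.rightNext.1 :: rightPath.drop (σ.right + 1) := by
  decide +kernel

end Progress

theorem meanNext_eq_mix {G S : Type} {Γ : TileSystem G} (P : Concentration Γ.tileSet)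
    {next : S → List (PlacedTile G × S)} {f : S → ℝ≥0∞} {s : S} {e e' : PlacedTile G × S}
    (h : next s = [e, e']) :
    meanNext P next f s = mix (P.conc e.1.tile) (P.conc e'.1.tile) (f e.2) (f e'.2) := by
  simp [meanNext_apply, h, mix]

namespace Machine

variable {Q : Type} [DecidableEq Q] {M : Machine Q} (P : Concentration M.system.tileSet)
  {h : List Bool} {σ : Progress} {s : State} {u : PlacedTile ℕ}

/-- The concentrations of the given tiles. For the tiles of the race, the choice of the state
`M.start` does not matter. -/
def rates (l : List (PlacedTile ℕ)) : List ℝ≥0 :=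
  l.map fun u ↦ P.conc (u.tile.map (M.glue M.start))

theorem conc_start_ne_zero (hu : u ∈ gadgetItems) : P.conc (u.tile.map (M.glue M.start)) ≠ 0 :=
  (P.conc_pos _ (mem_tileSet_iff.2 ⟨_, List.mem_map_of_mem hu, _, M.start_mem, rfl⟩)).ne'

theorem conc_place (hu : u ∈ leftPath ++ rightPath) (q : Q) (k : ℕ) :
    P.conc (M.place q k u).tile = P.conc (u.tile.map (M.glue M.start)) := by
  rw [place_eq_place_of_glue_lt (r := M.start) (glue_lt_of_mem_path hu), place]

theorem exists_weights : ∃ α β : ℝ≥0∞, α + β = 1 ∧ 2⁻¹ ^ 12 ≤ α ∧ 2⁻¹ ^ 12 ≤ β ∧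
    ∀ x y, raceVal x y (rates P leftPath) (rates P rightPath) = α * x + β * y := by
  have hperm : (leftItems.map PlacedTile.tile).Perm (rightItems.map PlacedTile.tile) := by
    decide +kernel
  have hleft : ∀ u ∈ leftItems, u ∈ gadgetItems := by
    decide +kernel
  have hclaim : ∀ o, ∀ u ∈ (reportItems o).take 1, u.tile ∈ leftItems.map PlacedTile.tile := by
    decide +kernel
  have hmem {t : Tile ℕ} (ht : t ∈ leftItems.map PlacedTile.tile) :
      P.conc (t.map (M.glue M.start)) ∈ rates P leftItems := by
    obtain ⟨u, hu, rfl⟩ := List.mem_map.1 ht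
    exact List.mem_map_of_mem hu
  refine exists_race_weights (l := rates P leftItems) (r := rates P rightItems) ?_ ?_
    (hmem (hclaim true _ List.mem_cons_self)) (hmem (hclaim false _ List.mem_cons_self))
  · simpa only [rates, List.map_map, Function.comp_def] using
      hperm.map fun t ↦ P.conc (t.map (M.glue M.start))
  · simpa [rates] using fun u hu ↦ conc_start_ne_zero P (hleft u hu)

variable (κ : ℝ≥0∞) (g : List Bool → ℝ≥0∞)

/-- The expected value of `g` after the present race. -/
noncomputable def outcomeVal (s : State) : ℝ≥0∞ :=
  if s.2.report = 0 then
    raceVal (g (true :: s.1)) (g (false :: s.1)) (rates P (leftPath.drop s.2.left))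
      (rates P (rightPath.drop s.2.right))
  else g (s.2.winner :: s.1)

/-- If every attachment costs `κ`, and `g h` bounds the expected future costs after the bits `h`,
then the potential bounds the expected future costs in a state. -/
noncomputable def potential (s : State) : ℝ≥0∞ :=
  if M.run s.1 ∈ M.states then κ * (63 - s.2.count : ℕ) + outcomeVal P g s else g s.1

/-- The condition on `g` that makes the potential superharmonic: a gadget has at most `63` tiles. -/
def IsSupersolution : Prop :=
  ∀ h, M.run h ∈ M.states → κ * 63 +
    raceVal (g (true :: h)) (g (false :: h)) (rates P leftPath) (rates P rightPath) ≤ g h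

variable {κ g}

theorem IsSupersolution.potential_zero_le (hg : IsSupersolution P κ g) (h : List Bool) :
    potential P κ g (h, .zero) ≤ g h := by
  rw [potential]
  split_ifs with hrun
  · exact hg h hrun
  · rfl

theorem IsSupersolution.potential_advance_le (hg : IsSupersolution P κ g)
    (hrun : M.run h ∈ M.states) (σ : Progress) :
    potential P κ g (advance h σ) ≤ κ * (63 - σ.count : ℕ) + outcomeVal P g (h, σ) := by
  unfold advance
  split_ifs with hfull
  · have hreport : σ.report ≠ 0 := by
      rw [hfull]
      cases σ.winner <;> decide
    refine (hg.potential_zero_le P _).trans ?_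
    rw [outcomeVal, if_neg hreport]
    exact le_add_self
  · rw [potential, if_pos hrun]

theorem outcomeVal_eq_mix (hσ : σ ∈ Progress.growing) (h0 : σ.report = 0) :
    outcomeVal P g (h, σ) = mix (P.conc (σ.leftNext.1.tile.map (M.glue M.start)))
      (P.conc (σ.rightNext.1.tile.map (M.glue M.start)))
      (outcomeVal P g (h, σ.leftNext.2)) (outcomeVal P g (h, σ.rightNext.2)) := by
  obtain ⟨hl, hr⟩ := Progress.drop_path_of_mem_growing σ hσ
  have hleft : outcomeVal P g (h, σ.leftNext.2) = raceVal (g (true :: h)) (g (false :: h))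
      (rates P (leftPath.drop (σ.left + 1))) (rates P (rightPath.drop σ.right)) := by
    unfold Progress.leftNext
    split_ifs with h6
    · rw [outcomeVal, if_pos h0]
    · rw [outcomeVal, if_neg one_ne_zero, List.drop_eq_nil_of_le (as := leftPath)]
      · simp [rates, raceVal]
      · simp [leftPath, leftItems, reportItems]
        omega
  have hright : outcomeVal P g (h, σ.rightNext.2) = raceVal (g (true :: h)) (g (false :: h))
      (rates P (leftPath.drop σ.left)) (rates P (rightPath.drop (σ.right + 1))) := by
    unfold Progress.rightNext
    split_ifs with h6
    · rw [outcomeVal, if_pos h0]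
    · rw [outcomeVal, if_neg one_ne_zero, List.drop_eq_nil_of_le (as := rightPath)]
      · simp [hl, rates, raceVal]
      · simp [rightPath, rightItems, reportItems]
        omega
  rw [hleft, hright, outcomeVal, if_pos h0, hl, hr]
  simp only [rates, List.map_cons, raceVal]

theorem meanNext_eq_mix_of_next_eq {f : State → ℝ≥0∞} (hrun : M.run h ∈ M.states)
    (hσ : σ ∈ Progress.growing) (hnext : σ.next = [σ.leftNext, σ.rightNext]) :
    meanNext P M.next f (h, σ) = mix (P.conc (σ.leftNext.1.tile.map (M.glue M.start)))
      (P.conc (σ.rightNext.1.tile.map (M.glue M.start)))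
      (f (advance h σ.leftNext.2)) (f (advance h σ.rightNext.2)) := by
  obtain ⟨hl, hr⟩ := Progress.drop_path_of_mem_growing σ hσ
  have hleft : σ.leftNext.1 ∈ leftPath ++ rightPath :=
    List.mem_append_left _ (List.mem_of_mem_drop (by rw [hl]; exact List.mem_cons_self))
  have hright : σ.rightNext.1 ∈ leftPath ++ rightPath :=
    List.mem_append_right _ (List.mem_of_mem_drop (by rw [hr]; exact List.mem_cons_self))
  have hnext' : M.next (h, σ) =
      [(M.place (M.run h) h.length σ.leftNext.1, advance h σ.leftNext.2),
        (M.place (M.run h) h.length σ.rightNext.1, advance h σ.rightNext.2)] := by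
    rw [next, if_pos hrun, hnext, List.map_cons, List.map_singleton]
  rw [meanNext_eq_mix P hnext', conc_place P hleft, conc_place P hright]

theorem outcomeVal_eq_of_mem_next (hσ : σ ∈ Progress.growing)
    (hrace : σ.report = 0 → σ.next ≠ [σ.leftNext, σ.rightNext]) {e : PlacedTile ℕ × Progress}
    (he : e ∈ σ.next) : outcomeVal P g (h, e.2) = outcomeVal P g (h, σ) := by
  by_cases h0 : σ.report = 0
  · obtain ⟨hm, hl, hr⟩ := (Progress.next_of_report_eq_zero σ hσ h0).resolve_left (hrace h0) e he
    simp only [outcomeVal, h0, hm, hl, hr, if_true]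
  · obtain ⟨hm, hw⟩ := Progress.report_ne_zero_of_mem_next h0 he
    simp only [outcomeVal, h0, hm, hw, if_false]

theorem IsSupersolution.meanNext_potential_le (hg : IsSupersolution P κ g) (hs : M.Valid s)
    (hn : M.next s ≠ []) :
    meanNext P M.next (potential P κ g) s + κ ≤ potential P κ g s := by
  obtain ⟨h, σ⟩ := s
  have hσ : σ ∈ Progress.growing := hs.growing
  have hrun : M.run h ∈ M.states := by
    by_contra hnot
    exact hn (if_neg hnot)
  set c : ℝ≥0∞ := κ * (63 - (σ.count + 1) : ℕ)
  have hpot {e : PlacedTile ℕ × Progress} (he : e ∈ σ.next) :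
      potential P κ g (advance h e.2) ≤ c + outcomeVal P g (h, e.2) := by
    simp only [c, ← (Progress.count_of_mem_next σ hσ e he).1]
    exact hg.potential_advance_le P hrun e.2
  suffices hmean : meanNext P M.next (potential P κ g) (h, σ) ≤ c + outcomeVal P g (h, σ) by
    have hcount : σ.count < 63 := by
      obtain ⟨e, he⟩ := List.exists_mem_of_ne_nil _ (Progress.next_ne_nil σ hσ)
      have := Progress.count_of_mem_next σ hσ e he
      omega
    calc meanNext P M.next (potential P κ g) (h, σ) + κ
        ≤ c + outcomeVal P g (h, σ) + κ := by gcongr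
      _ = κ * ((63 - (σ.count + 1) : ℕ) + 1 : ℕ) + outcomeVal P g (h, σ) := by
        rw [Nat.cast_add_one]
        ring
      _ = potential P κ g (h, σ) := by
        rw [potential, if_pos hrun, Nat.sub_add_eq, Nat.sub_add_cancel (by omega)]
  by_cases hrace : σ.report = 0 ∧ σ.next = [σ.leftNext, σ.rightNext]
  · rw [meanNext_eq_mix_of_next_eq P hrun hσ hrace.2, outcomeVal_eq_mix P hσ hrace.1,
      ← mix_const_add]
    · exact mix_mono (hpot (by simp [hrace.2])) (hpot (by simp [hrace.2]))
    · exact conc_start_ne_zero P (List.mem_of_mem_tail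
        (Progress.mem_gadgetItems_of_mem_next σ hσ σ.leftNext (by simp [hrace.2])))
  · refine meanNext_le P (fun e he ↦ (hs.attaches he).1) fun e he ↦ ?_
    obtain ⟨-, e, heσ, rfl⟩ := mem_next_iff.1 he
    exact (hpot heσ).trans_eq
      (by rw [outcomeVal_eq_of_mem_next P hσ (not_and.1 hrace) heσ])

end Machine

end Potential

section Generator

/-- The state of the drawing of a random number: how many of its bits are known, their value, and an
outcome that awaits its partner. -/
abbrev Counter : Type :=
  ℕ × ℕ × Option Bool

/-- The effect of one outcome on the drawing of a number below `n` with `k` bits. Two different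
outcomes yield a bit, and equal ones are ignored. A number that is not below `n` is rejected. -/
def drawStep (n k : ℕ) : Counter → Bool → Counter
  | (i, a, none), o => (i, a, some o)
  | (i, a, some b), o =>
    if o = b ∨ k ≤ i then (i, a, none)
    else if i + 1 = k ∧ n ≤ 2 * a + b.toNat then (0, 0, none) else (i + 1, 2 * a + b.toNat, none)

/-- The counter after the given outcomes, the head of the list being the last one. -/
def draw (n k : ℕ) : List Bool → Counter
  | [] => (0, 0, none)
  | o :: h => drawStep n k (draw n k h) o

/-- The variant of `drawStep` that has only `O(k)` states, as it replaces the value of the bits by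
its comparison with the leading bits of `n`. -/
def compareStep (n k : ℕ) : ℕ × Ordering × Option Bool → Bool → ℕ × Ordering × Option Bool
  | (i, c, none), o => (i, c, some o)
  | (i, c, some b), o =>
    if o = b ∨ k ≤ i then (i, c, none)
    else if i + 1 = k ∧ c.then (compare b.toNat (n / 2 ^ (k - (i + 1)) % 2)) ≠ .lt then
      (0, .eq, none)
    else (i + 1, c.then (compare b.toNat (n / 2 ^ (k - (i + 1)) % 2)), none)

/-- The states in which some of the `k` bits are unknown. -/
def generatorStates (k : ℕ) : Finset (ℕ × Ordering × Option Bool) :=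
  Finset.range k ×ˢ {.lt, .eq, .gt} ×ˢ Finset.univ

theorem mem_generatorStates {k : ℕ} {q : ℕ × Ordering × Option Bool} :
    q ∈ generatorStates k ↔ q.1 < k := by
  obtain ⟨i, c, b⟩ := q
  cases c <;> simp [generatorStates]

theorem card_generatorStates (k : ℕ) : (generatorStates k).card = 9 * k := by
  rw [generatorStates, Finset.card_product, Finset.card_product, Finset.card_range, mul_comm]
  rfl

/-- The machine that draws a random number below `n` with `k` bits. -/
def generator (n k : ℕ) (hk : 0 < k) : Machine (ℕ × Ordering × Option Bool) where
  δ := compareStep n k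
  states := generatorStates k
  start := (0, .eq, none)
  start_mem := mem_generatorStates.2 hk

variable {n k : ℕ}

theorem compare_two_mul_add (a m : ℕ) (b : Bool) :
    compare (2 * a + b.toNat) m = (compare a (m / 2)).then (compare b.toNat (m % 2)) := by
  have hb : b.toNat ≤ 1 := b.toNat_le
  simp only [Nat.compare_eq_ite_lt]
  split_ifs <;> first | omega | rfl

/-- The state of the generator that belongs to a counter. -/
def Counter.abstract (n k : ℕ) (s : Counter) : ℕ × Ordering × Option Bool :=
  (s.1, compare s.2.1 (n / 2 ^ (k - s.1)), s.2.2)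

theorem compareStep_abstract (hn : n < 2 ^ k) (s : Counter) (o : Bool) :
    compareStep n k (s.abstract n k) o = (drawStep n k s o).abstract n k := by
  obtain ⟨i, a, _ | b⟩ := s
  · rfl
  simp only [Counter.abstract, compareStep, drawStep]
  by_cases hskip : o = b ∨ k ≤ i
  · simp only [if_pos hskip]
  have hcompare : (compare a (n / 2 ^ (k - i))).then (compare b.toNat (n / 2 ^ (k - (i + 1)) % 2)) =
      compare (2 * a + b.toNat) (n / 2 ^ (k - (i + 1))) := by
    rw [compare_two_mul_add, Nat.div_div_eq_div_mul, ← pow_succ,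
      show k - (i + 1) + 1 = k - i by omega]
  have hreject : (i + 1 = k ∧ compare (2 * a + b.toNat) (n / 2 ^ (k - (i + 1))) ≠ .lt) ↔
      (i + 1 = k ∧ n ≤ 2 * a + b.toNat) := by
    refine and_congr_right fun hik ↦ ?_
    rw [hik, Nat.sub_self, pow_zero, Nat.div_one, ne_eq, compare_lt_iff_lt, not_lt]
  rw [if_neg hskip, if_neg hskip, hcompare]
  simp only [hreject]
  split_ifs
  · simp only [Nat.sub_zero, Nat.div_eq_of_lt hn]
    rfl
  · rfl

theorem run_generator (hk : 0 < k) (hn : n < 2 ^ k) (h : List Bool) :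
    (generator n k hk).run h = (draw n k h).abstract n k := by
  induction h with
  | nil => simp [Machine.run, draw, Counter.abstract, generator, Nat.div_eq_of_lt hn]
  | cons o h ih =>
    rw [Machine.run, ih]
    exact compareStep_abstract hn _ _

theorem run_generator_mem_states_iff (hk : 0 < k) (hn : n < 2 ^ k) (h : List Bool) :
    (generator n k hk).run h ∈ (generator n k hk).states ↔ (draw n k h).1 < k := by
  rw [run_generator hk hn]
  exact mem_generatorStates

theorem draw_lt (hk : 0 < k) (h : List Bool) (hi : k ≤ (draw n k h).1) :
    (draw n k h).2.1 < n := by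
  induction h with
  | nil => exact absurd hi (not_le.2 hk)
  | cons o h ih =>
    rw [draw] at hi ⊢
    generalize draw n k h = s at *
    obtain ⟨i, a, _ | b⟩ := s
    · exact ih hi
    · simp only [drawStep] at hi ih ⊢
      grind

/-- The expected costs when `r` bits are unknown and the value of the known ones is `a`: every bit
costs `c`, a number `u < n` costs `term u`, and a rejection costs `F₀`. -/
noncomputable def bitVal (n : ℕ) (c : ℝ≥0∞) (term : ℕ → ℝ≥0∞) (F₀ : ℝ≥0∞) : ℕ → ℕ → ℝ≥0∞
  | 0, u => if u < n then term u else F₀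
  | r + 1, a => c + (bitVal n c term F₀ r (2 * a) + bitVal n c term F₀ r (2 * a + 1)) / 2

variable {c F₀ : ℝ≥0∞} {term : ℕ → ℝ≥0∞}

theorem bitVal_eq_sum_range (r a : ℕ) : bitVal n c term F₀ r a =
    r * c + (∑ u ∈ Finset.range (2 ^ r), bitVal n c term F₀ 0 (a * 2 ^ r + u)) / 2 ^ r := by
  induction r generalizing a with
  | zero => simp
  | succ r ih =>
    set f := bitVal n c term F₀ 0
    have hsum : ∑ u ∈ Finset.range (2 ^ (r + 1)), f (a * 2 ^ (r + 1) + u) =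
        ∑ u ∈ Finset.range (2 ^ r), f (2 * a * 2 ^ r + u) +
        ∑ u ∈ Finset.range (2 ^ r), f ((2 * a + 1) * 2 ^ r + u) := by
      rw [pow_succ, mul_two, Finset.sum_range_add]
      congr! 3 <;> ring
    have hinv : ((2 : ℝ≥0∞) ^ (r + 1))⁻¹ = (2 ^ r)⁻¹ * 2⁻¹ := by
      rw [pow_succ, ENNReal.mul_inv (.inr (by simp)) (.inr (by simp))]
    rw [bitVal, ih, ih, hsum]
    generalize ∑ u ∈ Finset.range (2 ^ r), f (2 * a * 2 ^ r + u) = A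
    generalize ∑ u ∈ Finset.range (2 ^ r), f ((2 * a + 1) * 2 ^ r + u) = B
    simp only [div_eq_mul_inv, hinv, Nat.cast_add_one]
    calc c + (r * c + A * (2 ^ r)⁻¹ + (r * c + B * (2 ^ r)⁻¹)) * 2⁻¹
        = c + r * c * (2⁻¹ + 2⁻¹) + (A + B) * ((2 ^ r)⁻¹ * 2⁻¹) := by ring
      _ = (r + 1) * c + (A + B) * ((2 ^ r)⁻¹ * 2⁻¹) := by
        rw [ENNReal.inv_two_add_inv_two]
        ring

theorem bitVal_zero_right (hnk : n ≤ 2 ^ k) : bitVal n c term F₀ k 0 =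
    k * c + (∑ u ∈ Finset.range n, term u + (2 ^ k - n : ℕ) * F₀) / 2 ^ k := by
  obtain ⟨d, hd⟩ := Nat.exists_eq_add_of_le hnk
  have haccept : ∀ u ∈ Finset.range n, bitVal n c term F₀ 0 u = term u := fun u hu ↦
    if_pos (Finset.mem_range.1 hu)
  have hreject (u : ℕ) : bitVal n c term F₀ 0 (n + u) = F₀ := if_neg (by omega)
  rw [bitVal_eq_sum_range]
  simp only [zero_mul, zero_add]
  rw [hd, Finset.sum_range_add, Finset.sum_congr rfl haccept, Nat.add_sub_cancel_left]
  simp [hreject]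

theorem bitVal_ne_top (hc : c ≠ ⊤) (ht : ∀ u, term u ≠ ⊤) (hF : F₀ ≠ ⊤) (r a : ℕ) :
    bitVal n c term F₀ r a ≠ ⊤ := by
  induction r generalizing a with
  | zero =>
    rw [bitVal]
    split_ifs
    exacts [ht _, hF]
  | succ r ih =>
    rw [bitVal]
    exact ENNReal.add_ne_top.2
      ⟨hc, ENNReal.div_ne_top (ENNReal.add_ne_top.2 ⟨ih _, ih _⟩) two_ne_zero⟩

theorem bitVal_indicator (hnk : n ≤ 2 ^ k) {v : ℕ} (hv : v < n) :
    bitVal n 0 (fun u ↦ if u = v then 1 else 0) (n : ℝ≥0∞)⁻¹ k 0 = (n : ℝ≥0∞)⁻¹ := by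
  have hn : (n : ℝ≥0∞) ≠ 0 := Nat.cast_ne_zero.2 (Nat.ne_zero_of_lt hv)
  rw [bitVal_zero_right hnk, Finset.sum_ite_eq', if_pos (Finset.mem_range.2 hv), mul_zero, zero_add]
  calc (1 + (2 ^ k - n : ℕ) * (n : ℝ≥0∞)⁻¹) / 2 ^ k
      = (n + (2 ^ k - n : ℕ)) * (n : ℝ≥0∞)⁻¹ / 2 ^ k := by
        rw [add_mul, ENNReal.mul_inv_cancel hn (by finiteness)]
    _ = 2 ^ k * (n : ℝ≥0∞)⁻¹ / 2 ^ k := by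
        rw [← Nat.cast_add, Nat.add_sub_cancel' hnk, Nat.cast_pow, Nat.cast_ofNat]
    _ = (n : ℝ≥0∞)⁻¹ := by
        rw [mul_div_assoc, mul_comm, ENNReal.div_mul_cancel (by simp) (by finiteness)]

/-- As a number is accepted with probability at least `1 / 2`, two attempts are expected. -/
theorem bitVal_zero_le (hnk : n ≤ 2 ^ k) (hkn : 2 ^ k ≤ 2 * n) :
    bitVal n c 0 (2 * k * c) k 0 ≤ 2 * k * c := by
  rw [bitVal_zero_right hnk]
  simp only [Pi.zero_apply, Finset.sum_const_zero, zero_add]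
  have hreject : (2 ^ k - n : ℕ) * (2 : ℝ≥0∞) ≤ 2 ^ k := by
    exact_mod_cast (show (2 ^ k - n) * 2 ≤ 2 ^ k by omega)
  calc k * c + (2 ^ k - n : ℕ) * (2 * k * c) / 2 ^ k
      = k * c + (2 ^ k - n : ℕ) * 2 * (k * c) / 2 ^ k := by ring_nf
    _ ≤ k * c + 2 ^ k * (k * c) / 2 ^ k := by gcongr
    _ = 2 * k * c := by
      rw [mul_div_assoc, ENNReal.mul_div_cancel (by simp) (by finiteness)]
      ring

/-- The expected costs of a counter, where `F` is the function `bitVal`, every outcome costs `K`,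
and it is `true` with probability `α` and `false` with probability `β`. -/
noncomputable def drawVal (k : ℕ) (F : ℕ → ℕ → ℝ≥0∞) (α β K : ℝ≥0∞) : Counter → ℝ≥0∞
  | (i, a, none) => F (k - i) a
  | (i, a, some true) => K + (α * F (k - i) a + β * F (k - (i + 1)) (2 * a + 1))
  | (i, a, some false) => K + (α * F (k - (i + 1)) (2 * a) + β * F (k - i) a)

variable {α β K : ℝ≥0∞}

theorem drawVal_ne_top {F : ℕ → ℕ → ℝ≥0∞} (hF : ∀ r a, F r a ≠ ⊤) (hα : α ≠ ⊤) (hβ : β ≠ ⊤)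
    (hK : K ≠ ⊤) (s : Counter) : drawVal k F α β K s ≠ ⊤ := by
  have hsum (r a r' a' : ℕ) : K + (α * F r a + β * F r' a') ≠ ⊤ := by
    have := hF r a
    have := hF r' a'
    finiteness
  obtain ⟨i, a, _ | _ | _⟩ := s
  exacts [hF _ _, hsum _ _ _ _, hsum _ _ _ _]

theorem drawVal_ite_le (hF : bitVal n c term F₀ k 0 ≤ F₀) (i a b : ℕ) :
    drawVal k (bitVal n c term F₀) α β K
        (if i + 1 = k ∧ n ≤ 2 * a + b then (0, 0, none) else (i + 1, 2 * a + b, none)) ≤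
      bitVal n c term F₀ (k - (i + 1)) (2 * a + b) := by
  split_ifs with hreject
  · rw [drawVal, Nat.sub_zero, hreject.1, Nat.sub_self]
    exact hF.trans_eq (if_neg (by omega)).symm
  · rw [drawVal]

/-- Von Neumann's extractor: the outcomes `true, false` and `false, true` have the same probability
`α * β`, and so the bit is fair, and one waits for it `1 / (2 * α * β)` pairs of outcomes. -/
theorem pair_costs_le (hαβ : α + β = 1) (hK : K ≤ α * β * c) (T₀ T₁ : ℝ≥0∞) {S : ℝ≥0∞}
    (hS : S = c + (T₀ + T₁) / 2) :
    K + (α * (K + (α * S + β * T₁)) + β * (K + (α * T₀ + β * S))) ≤ S := by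
  have hS2 : 2 * S = 2 * c + (T₀ + T₁) := by
    rw [hS, mul_add, ENNReal.mul_div_cancel two_ne_zero ENNReal.ofNat_ne_top]
  calc K + (α * (K + (α * S + β * T₁)) + β * (K + (α * T₀ + β * S)))
      = K + (α + β) * K + (α * α + β * β) * S + α * β * (T₀ + T₁) := by ring
    _ ≤ α * β * c + α * β * c + (α * α + β * β) * S + α * β * (T₀ + T₁) := by
      rw [hαβ, one_mul]
      gcongr
    _ = α * β * (2 * c + (T₀ + T₁)) + (α * α + β * β) * S := by ring
    _ = (α + β) * (α + β) * S := by
      rw [← hS2]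
      ring
    _ = S := by rw [hαβ, one_mul, one_mul]

theorem drawVal_drawStep_le (hF : bitVal n c term F₀ k 0 ≤ F₀) (hαβ : α + β = 1)
    (hK : K ≤ α * β * c) (s : Counter) (hs : s.1 < k) :
    K + (α * drawVal k (bitVal n c term F₀) α β K (drawStep n k s true) +
      β * drawVal k (bitVal n c term F₀) α β K (drawStep n k s false)) ≤
    drawVal k (bitVal n c term F₀) α β K s := by
  obtain ⟨i, a, _ | _ | _⟩ := s <;> simp only at hs
  · simp only [drawStep, drawVal]
    refine pair_costs_le hαβ hK _ _ ?_
    rw [show k - i = k - (i + 1) + 1 by omega, bitVal]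
  · simp only [drawStep, drawVal, Bool.true_eq_false, false_or, true_or, if_true, hs.not_ge,
      if_false]
    gcongr
    exact drawVal_ite_le hF i a 0
  · simp only [drawStep, drawVal, Bool.false_eq_true, false_or, true_or, if_true, hs.not_ge,
      if_false]
    gcongr
    exact drawVal_ite_le hF i a 1

end Generator

section Outcomes

namespace Machine

variable {Q : Type} {M : Machine Q} {h w : List Bool}

theorem exists_claim (o : Bool) (hw : (o :: w) <:+ h) : ∃ a ∈ M.tilesBefore h,
    a.pos = (5 + 11 * (w.length : ℤ), 4) ∧ a.tile.north.1 = if o then 14 else 15 := by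
  induction h with
  | nil => simp at hw
  | cons o' h ih =>
    rcases List.suffix_cons_iff.1 hw with hw | hw
    · obtain ⟨rfl, rfl⟩ := List.cons.inj hw
      have hclaim : ∃ u ∈ (Progress.full o).items, u.pos = (5, 4) ∧
          u.tile.north = if o then 14 else 15 := by
        cases o <;> decide
      obtain ⟨u, hu, hpos, hnorth⟩ := hclaim
      refine ⟨_, List.mem_append_right _ (List.mem_map_of_mem hu), by simp [place, hpos], ?_⟩
      cases o <;> simp [place, Tile.map, hnorth, glue]
    · obtain ⟨a, ha, hclaim⟩ := ih hw
      exact ⟨a, List.mem_append_left _ ha, hclaim⟩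

variable [DecidableEq Q] {s t : State}

theorem suffix_of_assembly_eq (hst : M.assembly s = M.assembly t) (hw : w <:+ s.1)
    (hlen : w.length ≤ t.1.length) : w <:+ t.1 := by
  induction w with
  | nil => exact List.nil_suffix
  | cons o w ih =>
    obtain ⟨p, hp⟩ := ih ((List.suffix_cons o w).trans hw) (Nat.le_of_succ_le hlen)
    obtain ⟨p, o', rfl⟩ : ∃ p' o', p = p' ++ [o'] := by
      refine (List.eq_nil_or_concat' p).resolve_left ?_
      rintro rfl
      simp [← hp] at hlen
    have hw' : (o' :: w) <:+ t.1 := ⟨p, by simpa using hp⟩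
    obtain ⟨a, ha, hapos, hanorth⟩ := exists_claim (M := M) o hw
    obtain ⟨b, hb, hbpos, hbnorth⟩ := exists_claim (M := M) o' hw'
    have hmem {s : State} {a : PlacedTile (Glue Q)} (ha : a ∈ M.tilesBefore s.1) :
        a ∈ (M.assembly s).tiles := List.mem_toFinset.2 (List.mem_append_left _ ha)
    have hab : a = b := (M.assembly s).pos_unique a (hmem ha) b (hst ▸ hmem hb)
      (hapos.trans hbpos.symm)
    have ho : o = o' := by
      rw [hab, hbnorth] at hanorth
      revert hanorth
      cases o <;> cases o' <;> simp
    exact ho ▸ hw'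

theorem run_mem_states_of_suffix (hs : Reach M.next ([], .zero) s) {o : Bool}
    (hw : (o :: w) <:+ s.1) : M.run w ∈ M.states := by
  induction hs with
  | refl => simp at hw
  | tail _ hst ih =>
    obtain ⟨b, hb⟩ := hst
    obtain ⟨hrun, e, -, he⟩ := mem_next_iff.1 hb
    obtain rfl := congrArg Prod.snd he
    unfold advance at hw
    split_ifs at hw
    · rcases List.suffix_cons_iff.1 hw with hw | hw
      · exact (List.cons.inj hw).2 ▸ hrun
      · exact ih hw
    · exact ih hw

theorem eq_of_assembly_eq (hs : Reach M.next ([], .zero) s) (ht : Reach M.next ([], .zero) t)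
    (hs' : M.run s.1 ∉ M.states) (ht' : M.run t.1 ∉ M.states)
    (hst : M.assembly s = M.assembly t) : s.1 = t.1 := by
  wlog hlen : s.1.length ≤ t.1.length generalizing s t
  · exact (this ht hs ht' hs' hst.symm (le_of_not_ge hlen)).symm
  obtain ⟨p, hp⟩ := suffix_of_assembly_eq hst List.suffix_rfl hlen
  rcases List.eq_nil_or_concat' p with rfl | ⟨p, o, rfl⟩
  · exact hp
  · exact absurd (run_mem_states_of_suffix ht ⟨p, by simpa using hp⟩) hs'

theorem Valid.next_eq_nil_iff (hs : M.Valid s) : M.next s = [] ↔ M.run s.1 ∉ M.states := by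
  rw [Machine.next]
  split_ifs with hrun <;> simp [hrun, Progress.next_ne_nil s.2 hs.growing]

theorem assembly_mem_terminal_iff (hs : Reach M.next ([], .zero) s) :
    M.assembly s ∈ M.system.terminal ↔ M.run s.1 ∉ M.states :=
  (M.represents.mem_terminal_iff hs).trans (valid_of_reach hs).next_eq_nil_iff

variable {ι : Type*} (value : List Bool → ι) {v : ι}

variable (M) in
/-- The terminal assemblies whose bits have the value `v`. -/
def terminalWith (v : ι) : Set (Assembly (Glue Q)) :=
  {A | ∃ s, Reach M.next ([], .zero) s ∧ M.run s.1 ∉ M.states ∧ value s.1 = v ∧ M.assembly s = A}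

theorem iUnion_terminalWith : ⋃ v, M.terminalWith value v = M.system.terminal := by
  ext A
  rw [Set.mem_iUnion]
  constructor
  · rintro ⟨v, s, hs, hrun, -, rfl⟩
    exact (assembly_mem_terminal_iff hs).2 hrun
  · intro hA
    obtain ⟨s, hs, rfl⟩ := M.represents.exists_reach_of_mem_producible hA.1
    exact ⟨value s.1, s, hs, (assembly_mem_terminal_iff hs).1 hA, rfl, rfl⟩

theorem pairwise_disjoint_terminalWith :
    Pairwise (Function.onFun Disjoint (M.terminalWith value)) := by
  intro v w hvw
  refine Set.disjoint_left.2 ?_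
  rintro _ ⟨s, hs, hs', rfl, rfl⟩ ⟨t, ht, ht', rfl, hts⟩
  exact hvw (congrArg value (eq_of_assembly_eq hs ht hs' ht' hts.symm))

variable {value} (P : Concentration M.system.tileSet) {κ : ℝ≥0∞} {g : List Bool → ℝ≥0∞}

theorem probOf_terminalWith_le (hg : IsSupersolution P 0 g)
    (hone : ∀ o w, M.run w ∈ M.states → M.run (o :: w) ∉ M.states → value (o :: w) = v →
      1 ≤ g (o :: w)) :
    TileSystem.probOf P (M.terminalWith value v) ≤ g [] := by
  refine (M.represents.probOf_le P (f := potential P 0 g) ?_ ?_ fun s hs hn ↦ ?_).trans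
    (hg.potential_zero_le P [])
  · exact (Set.subset_iUnion _ v).trans_eq (iUnion_terminalWith value)
  · rintro s hs ⟨t, ht, ht', hv, hts⟩
    have hrun : M.run s.1 ∉ M.states := by
      rw [← assembly_mem_terminal_iff hs, ← hts, assembly_mem_terminal_iff ht]
      exact ht'
    rw [eq_of_assembly_eq ht hs ht' hrun hts] at hv
    rw [potential, if_neg hrun]
    rcases hw : s.1 with _ | ⟨o, w⟩
    · rw [hw] at hrun
      exact absurd M.start_mem hrun
    · rw [hw] at hv hrun
      exact hone o w (run_mem_states_of_suffix hs ⟨[], hw.symm⟩) hrun hv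
  · simpa using hg.meanNext_potential_le P (valid_of_reach hs) hn

theorem potential_ne_top (hκ : κ ≠ ⊤) (hg : ∀ h, g h ≠ ⊤) (s : State) :
    potential P κ g s ≠ ⊤ := by
  have hleft : ∀ u ∈ leftPath, u ∈ gadgetItems := by
    decide +kernel
  have houtcome : outcomeVal P g s ≠ ⊤ := by
    rw [outcomeVal]
    split_ifs
    · refine ne_top_of_le_ne_top (ENNReal.add_ne_top.2 ⟨hg _, hg _⟩) (raceVal_le_add ?_ _ _ _)
      intro c hc
      obtain ⟨u, hu, rfl⟩ := List.mem_map.1 hc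
      exact conc_start_ne_zero P (hleft u (List.mem_of_mem_drop hu))
    · exact hg _
  rw [potential]
  split_ifs
  · finiteness
  · exact hg _

theorem isFinite (hg : IsSupersolution P 1 g) (hfin : ∀ h, g h ≠ ⊤) : M.system.IsFinite :=
  M.represents.isFinite P (potential_ne_top P ENNReal.one_ne_top hfin) fun _ hs hn ↦
    hg.meanNext_potential_le P (valid_of_reach hs) hn

theorem probOf_terminal (hg : IsSupersolution P 1 g) (hfin : ∀ h, g h ≠ ⊤) :
    TileSystem.probOf P M.system.terminal = 1 :=
  M.represents.probOf_terminal P (potential_ne_top P ENNReal.one_ne_top hfin _) fun _ hs hn ↦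
    hg.meanNext_potential_le P (valid_of_reach hs) hn

variable (M) in
theorem space_seed : M.system.seed.space = 1 :=
  rfl

variable (M) in
theorem tileSet_nonempty : M.system.tileSet.Nonempty := by
  obtain ⟨a, ha⟩ := Finset.card_pos.1 (M.space_seed.symm ▸ one_pos : 0 < M.system.seed.space)
  exact ⟨a.tile, M.system.seed_mem a ha⟩

theorem expectedSpace_le (hg : IsSupersolution P 1 g) :
    TileSystem.expectedSpace P ≤ g [] + 1 := by
  refine (M.represents.expectedSpace_le P fun _ hs hn ↦
    hg.meanNext_potential_le P (valid_of_reach hs) hn).trans ?_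
  rw [space_seed, Nat.cast_one]
  gcongr
  exact hg.potential_zero_le P []

end Machine

end Outcomes

section FairGenerator

theorem TileSystem.probOf_iUnion {G : Type} {ι : Type*} [Fintype ι] {Γ : TileSystem G}
    (P : Concentration Γ.tileSet) {X : ι → Set (Assembly G)}
    (hX : Pairwise (Function.onFun Disjoint X)) :
    TileSystem.probOf P (⋃ i, X i) = ∑ i, TileSystem.probOf P (X i) := by
  simp only [TileSystem.probOf]
  rw [ENNReal.tsum_biUnion (f := TileSystem.probTerm P) fun i _ j _ hij ↦ hX hij, tsum_fintype]

theorem eq_of_le_of_sum_eq {ι : Type*} [Fintype ι] {x : ι → ℝ≥0∞} {a : ℝ≥0∞} (ha : a ≠ ⊤)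
    (hle : ∀ i, x i ≤ a) (hsum : ∑ i, x i = Fintype.card ι * a) (i : ι) : x i = a := by
  lift x to ι → ℝ≥0 using fun i ↦ ne_top_of_le_ne_top ha (hle i)
  lift a to ℝ≥0 using ha
  beta_reduce at *
  norm_cast at hle hsum ⊢
  refine (Finset.sum_eq_sum_iff_of_le fun i _ ↦ hle i).1 ?_ i (Finset.mem_univ i)
  rw [hsum, Finset.sum_const, nsmul_eq_mul, Finset.card_univ]

theorem le_mul_of_inv_le {x a m : ℝ≥0∞} (hm₀ : m ≠ 0) (hm : m ≠ ⊤) (h : m⁻¹ ≤ x) :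
    a ≤ x * (a * m) := by
  calc a = m⁻¹ * (a * m) := by
        rw [mul_comm a, ENNReal.inv_mul_cancel_left hm₀ hm]
    _ ≤ x * (a * m) := by gcongr

/-- A bound for the expected number of tiles per random bit: a gadget has `63` tiles, and
von Neumann's extractor works on outcomes with probabilities of at least `2⁻¹ ^ 12`. -/
noncomputable def bitCost : ℝ≥0∞ :=
  63 * 2 ^ 24

variable {n k : ℕ} {hk : 0 < k}

theorem exists_isSupersolution_drawVal (hn : n < 2 ^ k)
    (P : Concentration (generator n k hk).system.tileSet) :
    ∃ α β : ℝ≥0∞, α ≠ ⊤ ∧ β ≠ ⊤ ∧ (2 ^ 24)⁻¹ ≤ α * β ∧ ∀ {κ c F₀ : ℝ≥0∞} {term : ℕ → ℝ≥0∞},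
      κ * 63 ≤ α * β * c → bitVal n c term F₀ k 0 ≤ F₀ →
      Machine.IsSupersolution P κ
        fun h ↦ drawVal k (bitVal n c term F₀) α β (κ * 63) (draw n k h) := by
  obtain ⟨α, β, hαβ, hα, hβ, hrace⟩ := Machine.exists_weights P
  have hα' : α ≠ ⊤ := ne_top_of_le_ne_top ENNReal.one_ne_top (hαβ ▸ le_self_add)
  have hβ' : β ≠ ⊤ := ne_top_of_le_ne_top ENNReal.one_ne_top (hαβ ▸ le_add_self)
  refine ⟨α, β, hα', hβ', ?_, fun hκ hF h hrun ↦ ?_⟩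
  · calc ((2 : ℝ≥0∞) ^ 24)⁻¹ = 2⁻¹ ^ 12 * 2⁻¹ ^ 12 := by
          rw [← pow_add, ENNReal.inv_pow]
      _ ≤ α * β := by gcongr
  · rw [hrace]
    exact drawVal_drawStep_le hF hαβ hκ _ ((run_generator_mem_states_iff hk hn h).1 hrun)

theorem exists_isSupersolution_one (hn : n < 2 ^ k) (hkn : 2 ^ k ≤ 2 * n)
    (P : Concentration (generator n k hk).system.tileSet) :
    ∃ g, Machine.IsSupersolution P 1 g ∧ (∀ h, g h ≠ ⊤) ∧ g [] ≤ 2 * k * bitCost := by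
  obtain ⟨α, β, hα, hβ, hαβ, hsuper⟩ := exists_isSupersolution_drawVal hn P
  have hcost : bitCost ≠ ⊤ := by
    rw [bitCost]
    finiteness
  have hstart := bitVal_zero_le (c := bitCost) hn.le hkn
  refine ⟨_, hsuper ?_ hstart, fun h ↦ drawVal_ne_top ?_ hα hβ (by finiteness) _, hstart⟩
  · rw [one_mul]
    exact le_mul_of_inv_le (by simp) (by finiteness) hαβ
  · exact bitVal_ne_top hcost (fun _ ↦ ENNReal.zero_ne_top) (by finiteness)

theorem drawStep_eq_of_le {s : Counter} (hs : s.1 < k) {o : Bool}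
    (hi : k ≤ (drawStep n k s o).1) : (drawStep n k s o).2.2 = none := by
  obtain ⟨i, a, _ | b⟩ := s
  · exact absurd hi (not_le.2 hs)
  · simp only [drawStep]
    split_ifs <;> rfl

theorem exists_isSupersolution_zero (hn : n < 2 ^ k)
    (P : Concentration (generator n k hk).system.tileSet) (v : Fin n) :
    ∃ g, Machine.IsSupersolution P 0 g ∧ g [] = (n : ℝ≥0∞)⁻¹ ∧
      ∀ o w, (draw n k w).1 < k → k ≤ (draw n k (o :: w)).1 → (draw n k (o :: w)).2.1 = v →
        g (o :: w) = 1 := by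
  obtain ⟨α, β, -, -, -, hsuper⟩ := exists_isSupersolution_drawVal hn P
  have hstart := bitVal_indicator hn.le v.isLt
  refine ⟨_, hsuper (c := 0) (by simp) hstart.le, hstart, fun o w hw hi hv ↦ ?_⟩
  have hdraw : draw n k (o :: w) = ((draw n k (o :: w)).1, (v : ℕ), none) :=
    Prod.ext rfl (Prod.ext hv (drawStep_eq_of_le hw hi))
  rw [hdraw, drawVal, Nat.sub_eq_zero_of_le hi, bitVal, if_pos v.isLt, if_pos rfl]

theorem generator_isFinite (hn : n < 2 ^ k) (hkn : 2 ^ k ≤ 2 * n) :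
    (generator n k hk).system.IsFinite := by
  obtain ⟨g, hg, hfin, -⟩ := exists_isSupersolution_one hn hkn
    (Concentration.uniform (generator n k hk).tileSet_nonempty)
  exact Machine.isFinite _ hg hfin

theorem probOf_terminal_generator (hn : n < 2 ^ k) (hkn : 2 ^ k ≤ 2 * n)
    (P : Concentration (generator n k hk).system.tileSet) :
    TileSystem.probOf P (generator n k hk).system.terminal = 1 := by
  obtain ⟨g, hg, hfin, -⟩ := exists_isSupersolution_one hn hkn P
  exact Machine.probOf_terminal P hg hfin

theorem expectedSpace_generator_le (hn : n < 2 ^ k) (hkn : 2 ^ k ≤ 2 * n)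
    (P : Concentration (generator n k hk).system.tileSet) :
    TileSystem.expectedSpace P ≤ 2 * k * bitCost + 1 := by
  obtain ⟨g, hg, -, hstart⟩ := exists_isSupersolution_one hn hkn P
  refine (Machine.expectedSpace_le P hg).trans ?_
  gcongr

/-- The terminal assemblies of the generator that represent the number `v`. -/
def generatorPart (n k : ℕ) (hk : 0 < k) (v : Fin n) :
    Set (Assembly (Glue (ℕ × Ordering × Option Bool))) :=
  (generator n k hk).terminalWith (fun h ↦ (draw n k h).2.1) v

theorem pairwise_disjoint_generatorPart :
    Pairwise (Function.onFun Disjoint (generatorPart n k hk)) := fun _ _ hvw ↦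
  Machine.pairwise_disjoint_terminalWith _ (Fin.val_ne_of_ne hvw)

theorem iUnion_generatorPart (hn : n < 2 ^ k) :
    ⋃ v, generatorPart n k hk v = (generator n k hk).system.terminal := by
  rw [← Machine.iUnion_terminalWith fun h ↦ (draw n k h).2.1]
  refine subset_antisymm (Set.iUnion_subset fun v ↦ Set.subset_iUnion_of_subset (v : ℕ) subset_rfl)
    (Set.iUnion_subset fun v ↦ ?_)
  rintro A ⟨s, hs, hrun, rfl, hA⟩
  rw [run_generator_mem_states_iff hk hn, not_lt] at hrun
  exact Set.mem_iUnion.2 ⟨⟨_, draw_lt hk s.1 hrun⟩, s, hs,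
    (run_generator_mem_states_iff hk hn _).not.2 hrun.not_gt, rfl, hA⟩

theorem probOf_generatorPart_le (hn : n < 2 ^ k)
    (P : Concentration (generator n k hk).system.tileSet) (v : Fin n) :
    TileSystem.probOf P (generatorPart n k hk v) ≤ (n : ℝ≥0∞)⁻¹ := by
  obtain ⟨g, hg, hstart, hone⟩ := exists_isSupersolution_zero hn P v
  refine (Machine.probOf_terminalWith_le P hg fun o w hw how hv ↦ ?_).trans_eq hstart
  rw [run_generator_mem_states_iff hk hn] at hw how
  exact (hone o w hw (not_lt.1 how) hv).ge

/-- The upper bounds are attained, as they add up to `1`. -/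
theorem probOf_generatorPart (hn : n < 2 ^ k) (hkn : 2 ^ k ≤ 2 * n)
    (P : Concentration (generator n k hk).system.tileSet) (v : Fin n) :
    TileSystem.probOf P (generatorPart n k hk v) = (n : ℝ≥0∞)⁻¹ := by
  have hn₀ : (n : ℝ≥0∞) ≠ 0 := Nat.cast_ne_zero.2 v.pos.ne'
  refine eq_of_le_of_sum_eq (by finiteness) (probOf_generatorPart_le hn P) ?_ v
  rw [← TileSystem.probOf_iUnion P pairwise_disjoint_generatorPart, iUnion_generatorPart hn,
    probOf_terminal_generator hn hkn P, Fintype.card_fin,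
    ENNReal.mul_inv_cancel hn₀ (by finiteness)]

theorem nonempty_generatorPart (hn : n < 2 ^ k) (hkn : 2 ^ k ≤ 2 * n) (v : Fin n) :
    (generatorPart n k hk v).Nonempty := by
  by_contra hempty
  have hprob := probOf_generatorPart hn hkn
    (Concentration.uniform (generator n k hk).tileSet_nonempty) v
  rw [Set.not_nonempty_iff_eq_empty.1 hempty, TileSystem.probOf, tsum_empty] at hprob
  exact ENNReal.inv_ne_zero.2 (ENNReal.natCast_ne_top n) hprob.symm

theorem isFairRobustRandomGenerator_generator (hn : n < 2 ^ k) (hkn : 2 ^ k ≤ 2 * n) :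
    (generator n k hk).system.IsFairRobustRandomGenerator n := by
  refine ⟨generator_isFinite hn hkn, generatorPart n k hk, nonempty_generatorPart hn hkn,
    pairwise_disjoint_generatorPart, iUnion_generatorPart hn, fun P i j ↦ ?_⟩
  rw [probOf_generatorPart hn hkn, probOf_generatorPart hn hkn]
  exact le_self_add

theorem log_two_add_one_le (hn : n ≠ 0) : (Nat.log 2 n + 1 : ℝ) ≤ 2 * (Real.log n + 1) := by
  have hlog : (Nat.log 2 n : ℝ) * Real.log 2 ≤ Real.log n := by
    rw [← Real.log_pow]
    exact Real.log_le_log (by positivity) (by exact_mod_cast Nat.pow_log_le_self 2 hn)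
  have htwo : (Nat.log 2 n : ℝ) * 0.5 ≤ Nat.log 2 n * Real.log 2 := by
    gcongr
    linarith [Real.log_two_gt_d9]
  linarith

theorem card_tileSet_generator_le (n k : ℕ) (hk : 0 < k) :
    (generator n k hk).system.tileSet.card ≤ 675 * k := by
  have hcard := (generator n k hk).card_tileSet_le
  rw [generator, card_generatorStates] at hcard
  exact hcard.trans_eq (by ring)

theorem space_le_ofReal {x : ℝ} (hkx : (k : ℝ) ≤ 2 * x) (hk : 0 < k) :
    2 * k * bitCost + 1 ≤ ENNReal.ofReal (2 ^ 33 * x) := by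
  have hcast : 2 * k * bitCost + 1 = ENNReal.ofReal ((2 * k * (63 * 2 ^ 24) + 1 : ℕ) : ℝ) := by
    rw [ENNReal.ofReal_natCast, bitCost]
    push_cast
    ring
  have hk' : (1 : ℝ) ≤ k := Nat.one_le_cast.2 hk
  rw [hcast]
  refine ENNReal.ofReal_le_ofReal ?_
  push_cast
  linarith

end FairGenerator

end ATAM

/-- The additive `1` only matters for `n = 1`, where `log n = 0` but every tile set is non-empty. -/
theorem mainTheorem7 :
    ∃ C : ℝ, ∀ n : ℕ, 1 ≤ n → ∃ (G : Type) (Γ : ATAM.TileSystem G),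
      Γ.temperature = 2 ∧
      Γ.seed.space = 1 ∧
      Γ.Extensible 2 ∧
      (Γ.tileSet.card : ℝ) ≤ C * (Real.log n + 1) ∧
      Γ.IsFairRobustRandomGenerator n ∧
      ∀ P : ATAM.Concentration Γ.tileSet,
        ATAM.TileSystem.probOf P Γ.terminal = 1 ∧
        ATAM.TileSystem.expectedSpace P ≤ ENNReal.ofReal (C * (Real.log n + 1)) := by
  open ATAM in
  refine ⟨2 ^ 33, fun n hn ↦ ?_⟩
  have hn₀ : n ≠ 0 := Nat.one_le_iff_ne_zero.1 hn
  set k := Nat.log 2 n + 1 with hk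
  have hlt : n < 2 ^ k := Nat.lt_pow_succ_log_self one_lt_two n
  have hle : 2 ^ k ≤ 2 * n := by
    rw [hk, pow_succ']
    exact Nat.mul_le_mul_left 2 (Nat.pow_log_le_self 2 hn₀)
  have hlog : (k : ℝ) ≤ 2 * (Real.log n + 1) := by
    exact_mod_cast log_two_add_one_le hn₀
  have hk₀ : 0 < k := Nat.succ_pos _
  refine ⟨_, (generator n k hk₀).system, rfl, Machine.space_seed _, Machine.extensible _, ?_,
    isFairRobustRandomGenerator_generator hlt hle, fun P ↦
      ⟨probOf_terminal_generator hlt hle P,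
        (expectedSpace_generator_le hlt hle P).trans (space_le_ofReal hlog hk₀)⟩⟩
  have hcard : ((generator n k hk₀).system.tileSet.card : ℝ) ≤ 675 * k := by
    exact_mod_cast card_tileSet_generator_le n k hk₀
  have hk₁ : (1 : ℝ) ≤ k := Nat.one_le_cast.2 hk₀
  linarith
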